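/- Let $m,n\ge 0$ be integers. Manifolds are smooth Banach manifolds (in the sense of Lang), and a submersion is a smooth map whose tangent maps are surjective with complemented kernel. A simplicial manifold $K_\bullet$ is a *Lie $n$-groupoid* if the horn projections $K_l\to \mathrm{Hom}(\Lambda[l,j],K_\bullet)$, $0\le j\le l$, are surjective submersions onto manifolds for all $l\ge 1$ and diffeomorphisms for all $l>n$. A simplicial morphism $f_\bullet:K_\bullet\to J_\bullet$ of Lie $n$-groupoids is a *hypercover* if the maps $((d_0,\dots,d_i),f_i):K_i\to \partial_i(K_\bullet)\times_{\partial_i(J_\bullet)}J_i$, where $\partial_i(X_\bullet)=\mathrm{Hom}(\partial\Delta[i],X_\bullet)$, are surjective submersions onto manifolds for $0\le i<n$ and a diffeomorphism for $i=n$. An *$m$-shifted $k$-form* on a simplicial manifold $X_\bullet$ is a sum $\alpha_\bullet=\sum_{i=0}^m\alpha_i$ of forms $\alpha_i\in\Omega^{k+m-i}(X_i)$ that are normalised, i.e. $s_j^*\alpha_i=0$ for all degeneracies $s_j$ (so it is $0$ if $m=-1$). The total differential on $\Omega^q(X_p)$ is $D=\delta+(-1)^pd$, with $\delta=\sum_i(-1)^id_i^*$.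 The *tangent complex* of a Lie $n$-groupoid $K_\bullet$ has the fibres $\mathcal T_lK_x=\bigcap_{0\le i<l}\ker(T_xd_i)\subset T_xK_l$ at $x\in K_0$ (where $K_0\to K_l$ is the iterated degeneracy) and the differential $\partial=(-1)^lTd_l$; it is $0$ for $l<0$. A closed ($D\alpha_\bullet=0$) $m$-shifted $2$-form $\alpha_\bullet$ is *non-degenerate* if for all $x\in K_0$ and $l\in\mathbb Z$ the pairing $H_l(\mathcal TK)_x\times H_{m-l}(\mathcal TK)_x\to\mathbb R$ induced by $$\lambda_x(v,w)=\sum_{\sigma\in\mathrm{Shuff}_{l,m-l}}(-1)^\sigma\alpha_m\big(T(s_{\sigma(m-1)}\cdots s_{\sigma(l)})v,\;T(s_{\sigma(l-1)}\cdots s_{\sigma(0)})w\big)$$ (which is $0$ if $l<0$ or $l>m$) is non-degenerate, i.e. only the zero class pairs to zero with all classes, on either side. An *$m$-shifted symplectic Lie $n$-groupoid* is a pair $(K_\bullet,\alpha_\bullet)$ of a Lie $n$-groupoid and a closed non-degenerate $m$-shifted $2$-form on it. Two $m$-shifted symplectic Lie $n$-groupoids $(K_\bullet,\alpha_\bullet)$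 and $(J_\bullet,\beta_\bullet)$ are *symplectic Morita equivalent* if there are a Lie $n$-groupoid $Z_\bullet$, hypercovers $f_\bullet:Z_\bullet\to K_\bullet$ and $g_\bullet:Z_\bullet\to J_\bullet$, and an $(m-1)$-shifted $2$-form $\phi_\bullet$ on $Z_\bullet$ with $f_\bullet^*\alpha_\bullet-g_\bullet^*\beta_\bullet=D\phi_\bullet$. **Proposition.** For all $m,n\ge 0$, symplectic Morita equivalence is an equivalence relation (reflexive, symmetric and transitive) on $m$-shifted symplectic Lie $n$-groupoids. -/

import Mathlib

open CategoryTheory Opposite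
open scoped ContDiff

universe u

/-! ## Banach manifolds -/

/-- A smooth (`C^∞`) manifold modelled on real Banach spaces. The model space may vary from point to
point (so it may differ between components), and no separation or countability axiom is imposed.
An atlas is recorded by the choice of one chart around every point; the smooth structure is the one
generated by these charts. -/
structure BanachManifold : Type (u + 1) where
  carrier : Type u
  [topology : TopologicalSpace carrier]
  /-- the Banach space on which the manifold is modelled near `x` -/
  model : carrier → Type u
  [normedAddCommGroup : ∀ x, NormedAddCommGroup (model x)]
  [normedSpace : ∀ x, NormedSpace ℝ (model x)]
  [completeSpace : ∀ x, CompleteSpace (model x)]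
  chart : ∀ x, OpenPartialHomeomorph carrier (model x)
  mem_source : ∀ x, x ∈ (chart x).source
  /-- the transition maps are smooth -/
  transition : ∀ x y,
    ContDiffOn ℝ ∞ (chart y ∘ (chart x).symm) ((chart x).symm.trans (chart y)).source

namespace BanachManifold

instance : CoeSort BanachManifold.{u} (Type u) := ⟨carrier⟩

attribute [instance] topology normedAddCommGroup normedSpace completeSpace

/-- The tangent space at `x`, identified with the model space through the chart around `x`. -/
abbrev Tangent (M : BanachManifold.{u}) (x : M) : Type u := M.model x

/-- The expression of `f : M → N` in the chart around `x` and the chart around `f x`. -/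
def localRep {M N : BanachManifold.{u}} (f : M → N) (x : M) : M.model x → N.model (f x) :=
  N.chart (f x) ∘ f ∘ (M.chart x).symm

end BanachManifold

open BanachManifold

/-- Smooth maps of Banach manifolds: continuous, and smooth in charts around every point. -/
@[ext]
structure SmoothMap (M N : BanachManifold.{u}) : Type u where
  toFun : M → N
  continuous_toFun : Continuous toFun
  smooth_toFun : ∀ x, ContDiffAt ℝ ∞ (localRep toFun x) (M.chart x x)

namespace SmoothMap

instance {M N : BanachManifold.{u}} : CoeFun (SmoothMap M N) (fun _ => M → N) := ⟨toFun⟩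

/-- The identity map. -/
def id (M : BanachManifold.{u}) : SmoothMap M M where
  toFun x := x
  continuous_toFun := continuous_id
  smooth_toFun x := by
    have hx : M.chart x x ∈ (M.chart x).target := (M.chart x).map_source (M.mem_source x)
    refine contDiffAt_id.congr_of_eventuallyEq ?_
    filter_upwards [(M.chart x).open_target.mem_nhds hx] with y hy
    exact (M.chart x).right_inv hy

/-- Composition (first `f`, then `g`). -/
def comp {M N P : BanachManifold.{u}} (f : SmoothMap M N) (g : SmoothMap N P) :
    SmoothMap M P where
  toFun x := g (f x)
  continuous_toFun := g.continuous_toFun.comp f.continuous_toFun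
  smooth_toFun x := by
    have hx : M.chart x x ∈ (M.chart x).target := (M.chart x).map_source (M.mem_source x)
    have hxx : (M.chart x).symm (M.chart x x) = x := (M.chart x).left_inv (M.mem_source x)
    have hv : localRep f x (M.chart x x) = N.chart (f x) (f x) := by
      simp [localRep, hxx]
    have hg : ContDiffAt ℝ ∞ (localRep g (f x)) (localRep f x (M.chart x x)) := by
      rw [hv]
      exact g.smooth_toFun (f x)
    refine (hg.comp _ (f.smooth_toFun x)).congr_of_eventuallyEq ?_
    have hc : ContinuousAt (fun y => f ((M.chart x).symm y)) (M.chart x x) :=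
      f.continuous_toFun.continuousAt.comp ((M.chart x).symm.continuousAt hx)
    have hs : (N.chart (f x)).source ∈ nhds (f ((M.chart x).symm (M.chart x x))) := by
      rw [hxx]
      exact (N.chart (f x)).open_source.mem_nhds (N.mem_source (f x))
    filter_upwards [hc hs] with y hy
    simp only [localRep, Function.comp_apply]
    rw [(N.chart (f x)).left_inv hy]

end SmoothMap

/-- The category of Banach manifolds and smooth maps. Its isomorphisms are the diffeomorphisms. -/
instance : Category.{u} BanachManifold.{u} where
  Hom := SmoothMap
  id := SmoothMap.id
  comp := SmoothMap.comp

/-- The tangent map `T_x f : T_x M → T_{f x} N`. -/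
noncomputable def SmoothMap.tangentMap {M N : BanachManifold.{u}} (f : SmoothMap M N) (x : M) :
    M.Tangent x →L[ℝ] N.Tangent (f x) :=
  fderiv ℝ (localRep f x) (M.chart x x)

/-- A surjective submersion: a surjective smooth map all of whose tangent maps are surjective with
a complemented kernel. -/
structure IsSurjectiveSubmersion {M N : BanachManifold.{u}} (f : SmoothMap M N) : Prop where
  surjective : Function.Surjective f.toFun
  tangent_surjective : ∀ x, Function.Surjective (SmoothMap.tangentMap f x)
  ker_complemented : ∀ x, (LinearMap.ker (SmoothMap.tangentMap f x).toLinearMap).ClosedComplemented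

/-! ## Differential forms -/

/-- A (not necessarily smooth) differential form of degree `q` on `M`. -/
abbrev DiffForm (M : BanachManifold.{u}) (q : ℕ) : Type u :=
  ∀ x : M, M.Tangent x [⋀^Fin q]→L[ℝ] ℝ

namespace DiffForm

/-- The expression of a form in the chart around `x`, i.e. its pullback along the inverse of that
chart, a form on (the chart target in) the model space. -/
noncomputable def inChart {M : BanachManifold.{u}} {q : ℕ} (η : DiffForm M q) (x : M) :
    M.model x → M.model x [⋀^Fin q]→L[ℝ] ℝ :=
  fun y => (η ((M.chart x).symm y)).compContinuousLinearMap
    (fderiv ℝ (M.chart ((M.chart x).symm y) ∘ (M.chart x).symm) y)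

/-- Smooth differential forms, `η ∈ Ω^q(M)`. -/
def IsSmooth {M : BanachManifold.{u}} {q : ℕ} (η : DiffForm M q) : Prop :=
  ∀ x : M, ContDiffAt ℝ ∞ (η.inChart x) (M.chart x x)

/-- The de Rham differential of a (smooth) form, computed at `x` in the chart around `x`. -/
noncomputable def d {M : BanachManifold.{u}} {q : ℕ} (η : DiffForm M q) : DiffForm M (q + 1) :=
  fun x => extDeriv (η.inChart x) (M.chart x x)

/-- The pullback `f^* η`. -/
noncomputable def pullback {M N : BanachManifold.{u}} (f : SmoothMap M N) {q : ℕ}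
    (η : DiffForm N q) : DiffForm M q :=
  fun x => (η (f x)).compContinuousLinearMap (SmoothMap.tangentMap f x)

end DiffForm

/-! ## Simplicial manifolds, Lie `n`-groupoids and hypercovers -/

/-- A simplicial manifold. Its faces and degeneracies are `X.δ i` and `X.σ i`. -/
abbrev SimplicialManifold : Type (u + 1) := SimplicialObject BanachManifold.{u}

/-- The manifold `X_l` of `l`-simplices. -/
abbrev SimplicialManifold.level (X : SimplicialManifold.{u}) (l : ℕ) : BanachManifold.{u} :=
  X.obj (op (SimplexCategory.mk l))

/-- The functor taking a manifold `T` to the simplicial set `[k] ↦ C^∞(T, X_k)`. -/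
def simplicialPoints (X : SimplicialManifold.{u}) : BanachManifold.{u}ᵒᵖ ⥤ SSet.{u} :=
  coyoneda ⋙ (Functor.whiskeringLeft _ _ _).obj X

/-- A simplicial morphism induces a map of simplicial sets of `T`-points. -/
def simplicialPointsMap {X Y : SimplicialManifold.{u}} (f : X ⟶ Y) :
    simplicialPoints X ⟶ simplicialPoints Y :=
  Functor.whiskerLeft coyoneda ((Functor.whiskeringLeft _ _ _).map f)

/-- The space `Hom(S, X)` of a simplicial set `S` and a simplicial manifold `X`, as a presheaf on
manifolds: its `T`-points are the simplicial maps from `S` to `[k] ↦ C^∞(T, X_k)`. -/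
def homSpace (S : SSet.{u}) (X : SimplicialManifold.{u}) : BanachManifold.{u}ᵒᵖ ⥤ Type u :=
  simplicialPoints X ⋙ coyoneda.obj (op S)

/-- The tautological map from `Δ[l]` to the simplicial set of `X_l`-points of `X`. -/
def universalSimplex (X : SimplicialManifold.{u}) (l : ℕ) :
    SSet.stdSimplex.{u}.obj (.mk l) ⟶ (simplicialPoints X).obj (op (X.level l)) :=
  SSet.yonedaEquiv.symm (𝟙 (X.level l) : X.level l ⟶ X.level l)

/-- An element `p ∈ F(X)`, viewed as a map from the manifold `X` to the space `F`, is a surjective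
submersion: `F` is (represented by) a manifold `H`, and `p : X → H` is a surjective submersion. -/
def IsCoverOfSpace {X : BanachManifold.{u}} {F : BanachManifold.{u}ᵒᵖ ⥤ Type u}
    (p : F.obj (op X)) : Prop :=
  ∃ (H : BanachManifold.{u}) (r : F.RepresentableBy H),
    IsSurjectiveSubmersion (r.homEquiv.symm p : X ⟶ H)

/-- An element `p ∈ F(X)`, viewed as a map from the manifold `X` to the space `F`, is a
diffeomorphism: `F` is (represented by) a manifold `H`, and `p : X → H` is a diffeomorphism. -/
def IsDiffeoOntoSpace {X : BanachManifold.{u}} {F : BanachManifold.{u}ᵒᵖ ⥤ Type u}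
    (p : F.obj (op X)) : Prop :=
  ∃ (H : BanachManifold.{u}) (r : F.RepresentableBy H), IsIso (r.homEquiv.symm p : X ⟶ H)

/-- The horn projection `p_{l,j} : X_l → Hom(Λ[l,j], X)`. -/
def hornProjection (X : SimplicialManifold.{u}) (l : ℕ) (j : Fin (l + 1)) :
    (homSpace (SSet.horn.{u} l j) X).obj (op (X.level l)) :=
  (SSet.horn.{u} l j).ι ≫ universalSimplex X l

/-- Lie `n`-groupoids: the horn projections `p_{l,j}` are surjective submersions for `l ≥ 1` and
diffeomorphisms for `l > n`. -/
structure IsLieGroupoid (n : ℕ) (K : SimplicialManifold.{u}) : Prop where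
  kan : ∀ (l : ℕ) (j : Fin (l + 1)), 1 ≤ l → IsCoverOfSpace (hornProjection K l j)
  strict_kan : ∀ (l : ℕ) (j : Fin (l + 1)), n < l → IsDiffeoOntoSpace (hornProjection K l j)

/-- The fibre product `∂_i(K) ×_{∂_i(J)} J_i`, where `∂_i(X) = Hom(∂Δ[i], X)`, as a presheaf on
manifolds. -/
def relativeMatchingSpace {K J : SimplicialManifold.{u}} (f : K ⟶ J) (i : ℕ) :
    BanachManifold.{u}ᵒᵖ ⥤ Type u where
  obj T := { p : ((SSet.boundary.{u} i : SSet.{u}) ⟶ (simplicialPoints K).obj T) ×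
      (SSet.stdSimplex.{u}.obj (.mk i) ⟶ (simplicialPoints J).obj T) //
      p.1 ≫ (simplicialPointsMap f).app T = (SSet.boundary.{u} i).ι ≫ p.2 }
  map g := ↾fun p => ⟨(p.1.1 ≫ (simplicialPoints K).map g, p.1.2 ≫ (simplicialPoints J).map g), by
    have h := p.2
    rw [Category.assoc, (simplicialPointsMap f).naturality g, ← Category.assoc, h,
      Category.assoc]⟩
  map_id T := by
    ext p
    all_goals simp
  map_comp g h := by
    ext p
    all_goals simp

/-- The map `q_i = ((d_0, …, d_i), f_i) : K_i → ∂_i(K) ×_{∂_i(J)} J_i`. -/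
def relativeMatchingMap {K J : SimplicialManifold.{u}} (f : K ⟶ J) (i : ℕ) :
    (relativeMatchingSpace f i).obj (op (K.level i)) :=
  ⟨((SSet.boundary.{u} i).ι ≫ universalSimplex K i,
    universalSimplex K i ≫ (simplicialPointsMap f).app _), Category.assoc _ _ _⟩

/-- Hypercovers of Lie `n`-groupoids: `q_i` is a surjective submersion for `i < n` and a
diffeomorphism for `i = n`. -/
structure IsHypercover (n : ℕ) {K J : SimplicialManifold.{u}} (f : K ⟶ J) : Prop where
  cover : ∀ i, i < n → IsCoverOfSpace (relativeMatchingMap f i)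
  diffeo : IsDiffeoOntoSpace (relativeMatchingMap f n)

/-! ## The de Rham double complex and shifted forms -/

/-- Families `(α_{p,q})` of forms of degree `q` on `X_p`, i.e. (not necessarily smooth) elements of
the simplicial de Rham double complex. -/
abbrev DoubleForm (X : SimplicialManifold.{u}) : Type u := ∀ p q : ℕ, DiffForm (X.level p) q

namespace DoubleForm

variable {X Y : SimplicialManifold.{u}}

/-- The simplicial differential `δ = ∑_{i=0}^{p+1} (-1)^i d_i^* : Ω^q(X_p) → Ω^q(X_{p+1})`. -/
noncomputable def simplicialDiff {p q : ℕ} (η : DiffForm (X.level p) q) :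
    DiffForm (X.level (p + 1)) q :=
  ∑ i : Fin (p + 2), (-1 : ℝ) ^ (i : ℕ) • DiffForm.pullback (X.δ i) η

/-- The part of `D α` that comes from the simplicial differential `δ`. -/
noncomputable def deltaPart (α : DoubleForm X) : DoubleForm X
  | 0, _ => 0
  | p + 1, q => simplicialDiff (α p q)

/-- The part of `D α` that comes from `(-1)^p d`, where `d` is the de Rham differential. -/
noncomputable def deRhamPart (α : DoubleForm X) : DoubleForm X
  | _, 0 => 0
  | p, q + 1 => (-1 : ℝ) ^ p • DiffForm.d (α p q)

/-- The total differential `D = δ + (-1)^p d`. -/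
noncomputable def D (α : DoubleForm X) : DoubleForm X := deltaPart α + deRhamPart α

/-- The pullback along a simplicial morphism. -/
noncomputable def pullback (f : X ⟶ Y) (α : DoubleForm Y) : DoubleForm X :=
  fun p q => DiffForm.pullback (f.app (op (SimplexCategory.mk p))) (α p q)

/-- `m`-shifted `k`-forms: sums `α = ∑_{i=0}^m α_i` of normalised smooth forms `α_i` of degree
`k + m - i` on `X_i` (so `α = 0` if `m < 0`). -/
structure IsShifted (m : ℤ) (k : ℕ) (α : DoubleForm X) : Prop where
  smooth : ∀ p q, (α p q).IsSmooth
  eq_zero : ∀ p q : ℕ, ¬ ((p : ℤ) ≤ m ∧ (p : ℤ) + q = k + m) → α p q = 0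
  normalised : ∀ (p q : ℕ) (i : Fin (p + 1)), DiffForm.pullback (X.σ i) (α (p + 1) q) = 0

end DoubleForm

/-! ## The tangent complex and non-degeneracy -/

section TangentComplex

variable (X : SimplicialManifold.{u}) (x : X.level 0)

/-- The image of `x ∈ X_0` in `X_l` under the iterated degeneracy. -/
def basePoint (l : ℕ) : X.level l :=
  SmoothMap.toFun (X.map (SimplexCategory.const (.mk l) (.mk 0) 0).op) x

lemma map_basePoint {a b : ℕ} (θ : SimplexCategory.mk b ⟶ SimplexCategory.mk a) :
    SmoothMap.toFun (X.map θ.op) (basePoint X x a) = basePoint X x b := by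
  have h : X.map (SimplexCategory.const (.mk a) (.mk 0) 0).op ≫ X.map θ.op =
      X.map (SimplexCategory.const (.mk b) (.mk 0) 0).op := by
    rw [← X.map_comp, ← op_comp]
    congr 2
  exact congrArg (fun g : X.level 0 ⟶ X.level b => SmoothMap.toFun g x) h

/-- The fibre `T_x X_l` at `x` of the bundle `TX_l|_{X_0}`. -/
abbrev TangentFibre (l : ℕ) : Type u := (X.level l).Tangent (basePoint X x l)

/-- Transport of tangent vectors along an equality of base points. -/
def tangentTransport {M : BanachManifold.{u}} {y z : M} (h : y = z) :
    M.Tangent y →L[ℝ] M.Tangent z :=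
  h ▸ ContinuousLinearMap.id ℝ (M.Tangent y)

/-- The simplicial structure of `l ↦ T_x X_l`: the tangent map at the base point of the structure
map `X_a → X_b` that is given by `θ : [b] → [a]`. -/
noncomputable def tangentStructureMap {a b : ℕ} (θ : SimplexCategory.mk b ⟶ SimplexCategory.mk a) :
    TangentFibre X x a →L[ℝ] TangentFibre X x b :=
  (tangentTransport (map_basePoint X x θ)).comp (SmoothMap.tangentMap (X.map θ.op) (basePoint X x a))

/-- The fibre at `x` of the `l`-th term of the tangent complex: `T_x X_0` for `l = 0`, and for
`l > 0` the kernel of the tangent of the horn projection `p_{l,l}`, i.e. the intersection of the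
kernels of `T d_i` for `0 ≤ i < l`. -/
noncomputable def tangentComplex : ∀ l : ℕ, Submodule ℝ (TangentFibre X x l)
  | 0 => ⊤
  | l + 1 => ⨅ i : Fin (l + 1),
      LinearMap.ker (tangentStructureMap X x (SimplexCategory.δ i.castSucc)).toLinearMap

/-- The differential `∂ = (-1)^{l+1} T d_{l+1}` from degree `l + 1` to degree `l`. -/
noncomputable def tangentDiff (l : ℕ) : TangentFibre X x (l + 1) →L[ℝ] TangentFibre X x l :=
  (-1 : ℝ) ^ (l + 1) • tangentStructureMap X x (SimplexCategory.δ (Fin.last (l + 1)))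

/-- The cycles of the tangent complex at `x`. -/
noncomputable def tangentCycles : ∀ l : ℕ, Submodule ℝ (TangentFibre X x l)
  | 0 => tangentComplex X x 0
  | l + 1 => tangentComplex X x (l + 1) ⊓ LinearMap.ker (tangentDiff X x l).toLinearMap

/-- The boundaries of the tangent complex at `x`. -/
noncomputable def tangentBoundaries (l : ℕ) : Submodule ℝ (TangentFibre X x l) :=
  (tangentComplex X x (l + 1)).map (tangentDiff X x l).toLinearMap

/-- The homology of the tangent complex at `x`. -/
abbrev TangentHomology (l : ℕ) : Type u :=
  tangentCycles X x l ⧸ (tangentBoundaries X x l).submoduleOf (tangentCycles X x l)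

/-- `(a, b)`-shuffles: permutations `σ` of `{0, …, a+b-1}` that increase on the first `a` and on
the last `b` elements. -/
def IsShuffle (a b : ℕ) (σ : Equiv.Perm (Fin (a + b))) : Prop :=
  StrictMono (fun i : Fin a => σ (Fin.castAdd b i)) ∧
    StrictMono (fun i : Fin b => σ (Fin.natAdd a i))

/-- For `c : Fin k → Fin N` injective, the order-preserving map `[N] → [k]`,
`i ↦ #{t | c t < i}`. It is the surjection that identifies `j` and `j + 1` exactly for those `j`
that are not a value of `c`; hence the structure map `X_k → X_N` that it induces is the iterated
degeneracy `s_{j_r} ⋯ s_{j_1}`, where `j_1 < ⋯ < j_r` are the elements of `{0, …, N-1}` that are not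
values of `c`. -/
def collapse {k N : ℕ} (c : Fin k → Fin N) : SimplexCategory.mk N ⟶ SimplexCategory.mk k :=
  SimplexCategory.mkHom
    { toFun := fun i => ⟨(Finset.univ.filter fun t => (c t : ℕ) < (i : ℕ)).card,
        Nat.lt_succ_of_le ((Finset.card_le_univ _).trans_eq (Fintype.card_fin k))⟩
      monotone' := fun i j hij => Finset.card_le_card fun t ht => by
        simp only [Finset.mem_filter, Finset.mem_univ, true_and] at ht ⊢
        exact lt_of_lt_of_le ht hij }

variable {X}

open Classical in
/-- The IM-form
`λ_x(v, w) = ∑_σ (-1)^σ α_m(T(s_{σ(m-1)} ⋯ s_{σ(l)}) v, T(s_{σ(l-1)} ⋯ s_{σ(0)}) w)`,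
the sum over all `(l, l')`-shuffles, with `m = l + l'`. -/
noncomputable def imForm (α : DoubleForm X) (l l' : ℕ)
    (v : TangentFibre X x l) (w : TangentFibre X x l') : ℝ :=
  ∑ σ : Equiv.Perm (Fin (l + l')) with IsShuffle l l' σ,
    ((Equiv.Perm.sign σ : ℤ) : ℝ) * α (l + l') 2 (basePoint X x (l + l'))
      ![tangentStructureMap X x (collapse fun i : Fin l => σ (Fin.castAdd l' i)) v,
        tangentStructureMap X x (collapse fun i : Fin l' => σ (Fin.natAdd l i)) w]

/-- Non-degeneracy of an `m`-shifted `2`-form: at every point `x`, the pairing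
`H_l × H_{m-l} → ℝ` that the IM-form induces on the homology of the tangent complex is
non-degenerate for every `l ∈ ℤ`, i.e. a class that pairs to zero with every class is zero.
If `l > m`, then `H_{m-l} = 0` and this says that `H_l = 0`. -/
structure DoubleForm.IsNondegenerate (m : ℕ) (α : DoubleForm X) : Prop where
  left : ∀ (x : X.level 0) (l l' : ℕ), l + l' = m → ∀ v : tangentCycles X x l,
    (∀ w : tangentCycles X x l', imForm x α l l' v w = 0) →
      (Submodule.Quotient.mk v : TangentHomology X x l) = 0
  right : ∀ (x : X.level 0) (l l' : ℕ), l + l' = m → ∀ w : tangentCycles X x l',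
    (∀ v : tangentCycles X x l, imForm x α l l' v w = 0) →
      (Submodule.Quotient.mk w : TangentHomology X x l') = 0
  above : ∀ (x : X.level 0) (l : ℕ), m < l → Subsingleton (TangentHomology X x l)

end TangentComplex

/-! ## Shifted symplectic Lie `n`-groupoids and symplectic Morita equivalence -/

/-- `m`-shifted symplectic Lie `n`-groupoids `(K, α)`. -/
structure ShiftedSymplecticLieGroupoid (m n : ℕ) : Type (u + 1) where
  space : SimplicialManifold.{u}
  isLieGroupoid : IsLieGroupoid n space
  form : DoubleForm space
  isShifted : form.IsShifted m 2
  closed : form.D = 0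
  nondegenerate : form.IsNondegenerate m

/-- Symplectic Morita equivalence: a zig-zag `K ← Z → J` of hypercovers of Lie `n`-groupoids with an
`(m-1)`-shifted `2`-form `φ` on `Z` such that `f^* α - g^* β = D φ`. -/
def SymplecticMoritaEquivalent {m n : ℕ} (K J : ShiftedSymplecticLieGroupoid.{u} m n) : Prop :=
  ∃ (Z : SimplicialManifold.{u}) (f : Z ⟶ K.space) (g : Z ⟶ J.space) (φ : DoubleForm Z),
    IsLieGroupoid n Z ∧ IsHypercover n f ∧ IsHypercover n g ∧ φ.IsShifted ((m : ℤ) - 1) 2 ∧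
      DoubleForm.pullback f K.form - DoubleForm.pullback g J.form = φ.D

/-!
# Symplectic Morita equivalence is an equivalence relation

Reflexivity is witnessed by the identity and `φ = 0`, symmetry by `-φ`. For transitivity let
`K ← Z → J` and `J ← Z' → L` be two equivalences, and let `W = Z ×_J Z'`, levelwise, with projections `p`
and `p'`. If `W` is a Lie `n`-groupoid and the two projections are hypercovers, then so are the
composites to `K` and `L`, and `p^* φ + p'^* φ'` is the required form, because the pullbacks to `W`
of the form on `J` cancel. This uses that `D` commutes with pullbacks (`DoubleForm.D_pullback`). So
the point is that hypercovers can be pulled back and composed.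

Spaces of maps `Hom(A, X)` are treated as presheaves on the category of manifolds. A map of
presheaves is called a cover (`presheafCovers`) if all its pullbacks to manifolds are surjective
submersions of manifolds. Since surjective submersions of Banach manifolds can be pulled back
(`BanachManifold.isPullback_fibreProduct`, from the inverse function theorem), a map from a
manifold to a presheaf is a surjective submersion onto a manifold if and only if it is a cover and
the presheaf is representable (`isCoverOfSpace_iff`). Covers are stable under composition and base
change, and a presheaf that covers a representable one is representable.

The conditions on a hypercover `f : X → Y` concern its gap maps
`Hom(B, X) → Hom(A, X) ×_{Hom(A, Y)} Hom(B, Y)` at `A → B`, for `∂Δ[k] → Δ[k]` and `k ≤ n`.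

* For `k > n` the gap map at `∂Δ[k] → Δ[k]` is an isomorphism, because horns of dimension above `n`
  have unique fillers (`SSet.existsUnique_boundary_filler`, `IsHypercover.isIso_gapMap`). So the
  gap maps at all boundary inclusions are covers.
* The maps of simplicial sets at which the gap map of `f` is a cover are closed under composition
  and cobase change. As subcomplexes of simplices are built by attaching simplices along their
  boundaries (`SSet.homOfLE_mem_of_boundary_mem`), the gap map of `f` is a cover at all inclusions
  of subcomplexes; starting at the empty one, `Hom(A, X) → Hom(A, Y)` is a cover too. In particular
  `X_k → Y_k` is a surjective submersion, so that levelwise base changes of `f` exist.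
* A base change of `f` has gap maps that are base changes of those of `f`, and the horn projections
  of its source are composites of such gap maps and of base changes of horn projections. This gives
  `IsLieGroupoid.of_isPullback` and `IsHypercover.of_isPullback`; composites of hypercovers are
  similar (`IsHypercover.comp`). In both cases every space that has to be a manifold covers one
  that is.
-/

/-! ### Smoothness at a point -/

namespace BanachManifold

/-- A Banach space as a manifold, with the identity as its only chart. -/
@[reducible]
def ofBanach (V : Type u) [NormedAddCommGroup V] [NormedSpace ℝ V] [CompleteSpace V] :
    BanachManifold.{u} where
  carrier := V
  model _ := V
  chart _ := OpenPartialHomeomorph.refl V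
  mem_source _ := Set.mem_univ _
  transition _ _ := contDiff_id.contDiffOn

/-- Smoothness at a point of a map of Banach manifolds that need not be smooth, or even meaningful,
elsewhere. Charts, their inverses and maps between Banach spaces are treated on the same footing
by regarding Banach spaces as manifolds. -/
structure SmoothAt {M N : BanachManifold.{u}} (f : M → N) (x : M) : Prop where
  continuousAt : ContinuousAt f x
  contDiffAt : ContDiffAt ℝ ∞ (localRep f x) (M.chart x x)

variable {M N P : BanachManifold.{u}}

lemma chart_mem_target (M : BanachManifold.{u}) (x : M) : M.chart x x ∈ (M.chart x).target :=
  (M.chart x).map_source (M.mem_source x)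

@[simp]
lemma chart_symm_chart (M : BanachManifold.{u}) (x : M) : (M.chart x).symm (M.chart x x) = x :=
  (M.chart x).left_inv (M.mem_source x)

@[simp]
lemma localRep_chart (f : M → N) (x : M) : localRep f x (M.chart x x) = N.chart (f x) (f x) := by
  simp [localRep]

lemma localRep_eventuallyEq {f g : M → N} {x : M} (h : f =ᶠ[nhds x] g) :
    (fun v => N.chart (f x) (f ((M.chart x).symm v))) =ᶠ[nhds (M.chart x x)]
      fun v => N.chart (f x) (g ((M.chart x).symm v)) := by
  have hc : Filter.Tendsto (M.chart x).symm (nhds (M.chart x x)) (nhds x) := by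
    have := (M.chart x).symm.continuousAt (M.chart_mem_target x)
    rwa [ContinuousAt, chart_symm_chart] at this
  filter_upwards [hc h] with v hv
  exact congrArg _ hv

/-- Near `x` the local expression of a composite is the composite of the local expressions. -/
lemma localRep_comp_eventuallyEq {f : M → N} {x : M} (hf : ContinuousAt f x) (g : N → P) :
    localRep (fun y => g (f y)) x =ᶠ[nhds (M.chart x x)] localRep g (f x) ∘ localRep f x := by
  have hc : ContinuousAt (fun y => f ((M.chart x).symm y)) (M.chart x x) := by
    refine ContinuousAt.comp ?_ ((M.chart x).symm.continuousAt (M.chart_mem_target x))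
    simpa using hf
  have hs : (N.chart (f x)).source ∈ nhds (f ((M.chart x).symm (M.chart x x))) := by
    rw [chart_symm_chart]
    exact (N.chart (f x)).open_source.mem_nhds (N.mem_source (f x))
  filter_upwards [hc hs] with y hy
  simp only [localRep, Function.comp_apply]
  rw [(N.chart (f x)).left_inv hy]

namespace SmoothAt

lemma comp {f : M → N} {g : N → P} {x : M} (hg : SmoothAt g (f x)) (hf : SmoothAt f x) :
    SmoothAt (fun y => g (f y)) x where
  continuousAt := hg.continuousAt.comp hf.continuousAt
  contDiffAt := by
    have hg' : ContDiffAt ℝ ∞ (localRep g (f x)) (localRep f x (M.chart x x)) := by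
      rw [localRep_chart]
      exact hg.contDiffAt
    exact (hg'.comp _ hf.contDiffAt).congr_of_eventuallyEq
      (localRep_comp_eventuallyEq hf.continuousAt g)

lemma congr {f g : M → N} {x : M} (hf : SmoothAt f x) (h : g =ᶠ[nhds x] f) : SmoothAt g x where
  continuousAt := hf.continuousAt.congr h.symm
  contDiffAt := by
    have hx : g x = f x := h.self_of_nhds
    have h1 := localRep_eventuallyEq h
    have h2 : ContDiffAt ℝ ∞ (fun v => N.chart (g x) (f ((M.chart x).symm v))) (M.chart x x) := by
      rw [hx]
      exact hf.contDiffAt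
    exact h2.congr_of_eventuallyEq h1

end SmoothAt

lemma _root_.SmoothMap.smoothAt (f : SmoothMap M N) (x : M) : SmoothAt f.toFun x :=
  ⟨f.continuous_toFun.continuousAt, f.smooth_toFun x⟩

section Banach

variable {V W : Type u} [NormedAddCommGroup V] [NormedSpace ℝ V] [CompleteSpace V]
  [NormedAddCommGroup W] [NormedSpace ℝ W] [CompleteSpace W]

lemma smoothAt_ofBanach_iff {f : V → W} {x : V} :
    SmoothAt (M := ofBanach V) (N := ofBanach W) f x ↔ ContDiffAt ℝ ∞ f x :=
  ⟨fun h => h.contDiffAt, fun h => ⟨h.continuousAt, h⟩⟩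

lemma SmoothAt.prodMk {f : M → V} {g : M → W} {x : M} (hf : SmoothAt (N := ofBanach V) f x)
    (hg : SmoothAt (N := ofBanach W) g x) :
    SmoothAt (N := ofBanach (V × W)) (fun y => (f y, g y)) x :=
  ⟨hf.continuousAt.prodMk hg.continuousAt, hf.contDiffAt.prodMk hg.contDiffAt⟩

lemma SmoothAt.snd {f : M → V × W} {x : M} (hf : SmoothAt (N := ofBanach (V × W)) f x) :
    SmoothAt (N := ofBanach W) (fun y => (f y).2) x :=
  SmoothAt.comp (N := ofBanach (V × W)) (P := ofBanach W) (g := Prod.snd)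
    (smoothAt_ofBanach_iff.2 contDiffAt_snd) hf

end Banach

/-- Smoothness of the transition maps at a point of the overlap. -/
lemma contDiffAt_transition (M : BanachManifold.{u}) (a b : M) {z : M}
    (ha : z ∈ (M.chart a).source) (hb : z ∈ (M.chart b).source) :
    ContDiffAt ℝ ∞ (M.chart b ∘ (M.chart a).symm) (M.chart a z) := by
  refine (M.transition a b).contDiffAt
    (((M.chart a).symm.trans (M.chart b)).open_source.mem_nhds ?_)
  rw [OpenPartialHomeomorph.trans_source]
  exact ⟨(M.chart a).map_source ha, by simpa [(M.chart a).left_inv ha] using hb⟩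

lemma smoothAt_chart (M : BanachManifold.{u}) (a : M) {z : M} (ha : z ∈ (M.chart a).source) :
    SmoothAt (N := ofBanach (M.model a)) (M.chart a) z :=
  ⟨(M.chart a).continuousAt ha, M.contDiffAt_transition z a (M.mem_source z) ha⟩

lemma smoothAt_chart_symm (M : BanachManifold.{u}) (a : M) {v : M.model a}
    (hv : v ∈ (M.chart a).target) :
    SmoothAt (M := ofBanach (M.model a)) (M.chart a).symm v := by
  refine ⟨(M.chart a).symm.continuousAt hv, ?_⟩
  have := M.contDiffAt_transition a ((M.chart a).symm v) ((M.chart a).map_target hv)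
    (M.mem_source _)
  rwa [(M.chart a).right_inv hv] at this

/-- Smoothness into a manifold can be tested in the chart around the image point. -/
lemma SmoothAt.of_chart_comp {f : M → N} {x : M} (hc : ContinuousAt f x)
    (h : SmoothAt (N := ofBanach (N.model (f x))) (fun y => N.chart (f x) (f y)) x) :
    SmoothAt f x :=
  ⟨hc, h.contDiffAt⟩

/-- Smoothness out of a manifold can be tested in the chart around the point. -/
lemma SmoothAt.of_comp_chart_symm {f : M → N} {x : M}
    (h : SmoothAt (M := ofBanach (M.model x)) (fun v => f ((M.chart x).symm v)) (M.chart x x)) :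
    SmoothAt f x := by
  have h1 := SmoothAt.comp (f := M.chart x) (x := x) (N := ofBanach (M.model x)) h
    (M.smoothAt_chart x (M.mem_source x))
  refine h1.congr ?_
  filter_upwards [(M.chart x).open_source.mem_nhds (M.mem_source x)] with y hy
  rw [(M.chart x).left_inv hy]

/-- The expression of a smooth map in arbitrary charts is smooth. -/
lemma SmoothAt.contDiffAt_charts {f : M → N} {a : M} {b : N} {z : M} (hf : SmoothAt f z)
    (ha : z ∈ (M.chart a).source) (hb : f z ∈ (N.chart b).source) :
    ContDiffAt ℝ ∞ (fun v => N.chart b (f ((M.chart a).symm v))) (M.chart a z) := by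
  have h1 : SmoothAt (M := ofBanach (M.model a)) (M.chart a).symm (M.chart a z) :=
    M.smoothAt_chart_symm a ((M.chart a).map_source ha)
  have h0 : (M.chart a).symm (M.chart a z) = z := (M.chart a).left_inv ha
  have h2 : SmoothAt (M := ofBanach (M.model a)) (fun v => f ((M.chart a).symm v)) (M.chart a z) :=
    SmoothAt.comp (M := ofBanach (M.model a)) (f := (M.chart a).symm) (g := f) (by rwa [h0]) h1
  have h3 : SmoothAt (M := ofBanach (M.model a)) (N := ofBanach (N.model b))
      (fun v => N.chart b (f ((M.chart a).symm v))) (M.chart a z) :=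
    SmoothAt.comp (M := ofBanach (M.model a)) (P := ofBanach (N.model b))
      (f := fun v => f ((M.chart a).symm v)) (g := N.chart b)
      (N.smoothAt_chart b (by rwa [h0])) h2
  exact smoothAt_ofBanach_iff.1 h3

end BanachManifold

/-! ### Tangent maps and split submersions -/

namespace SmoothMap

variable {M N P : BanachManifold.{u}}

lemma differentiableAt_localRep (f : SmoothMap M N) (x : M) :
    DifferentiableAt ℝ (localRep f.toFun x) (M.chart x x) :=
  (f.smooth_toFun x).differentiableAt (by simp)

lemma tangentMap_comp (f : SmoothMap M N) (g : SmoothMap N P) (x : M) :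
    (f.comp g).tangentMap x = (g.tangentMap (f x)).comp (f.tangentMap x) := by
  have h := (localRep_comp_eventuallyEq (f.smoothAt x).continuousAt g.toFun).fderiv_eq (𝕜 := ℝ)
  refine h.trans ?_
  rw [fderiv_comp _ (by rw [localRep_chart]; exact g.differentiableAt_localRep (f x))
    (f.differentiableAt_localRep x), localRep_chart]
  rfl

lemma tangentMap_id (x : M) : (SmoothMap.id M).tangentMap x = ContinuousLinearMap.id ℝ _ := by
  have h : localRep (SmoothMap.id M).toFun x =ᶠ[nhds (M.chart x x)] _root_.id := by
    filter_upwards [(M.chart x).open_target.mem_nhds (M.chart_mem_target x)] with v hv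
    exact (M.chart x).right_inv hv
  exact h.fderiv_eq.trans fderiv_id

end SmoothMap

namespace ContinuousLinearMap

/-- A continuous linear map of Banach spaces has a continuous right inverse as soon as it is
surjective with complemented kernel. -/
lemma hasRightInverse_of_closedComplemented_ker {E F : Type*}
    [NormedAddCommGroup E] [NormedSpace ℝ E] [CompleteSpace E]
    [NormedAddCommGroup F] [NormedSpace ℝ F] [CompleteSpace F] {L : E →L[ℝ] F}
    (hs : Function.Surjective L) (hk : (LinearMap.ker L.toLinearMap).ClosedComplemented) :
    L.HasRightInverse := by
  obtain ⟨π, hπ⟩ := hk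
  have hcs : CompleteSpace (LinearMap.ker L.toLinearMap) :=
    (L.isClosed_ker).completeSpace_coe
  let e := L.equivProdOfSurjectiveOfIsCompl π (LinearMap.range_eq_top.2 hs)
    (LinearMap.range_eq_top.2 fun k => ⟨k, hπ k⟩) (LinearMap.isCompl_of_proj hπ)
  refine ⟨e.symm.toContinuousLinearMap.comp (ContinuousLinearMap.inl ℝ F _), fun y => ?_⟩
  have h : e (e.symm (y, 0)) = (y, 0) := e.apply_symm_apply _
  exact congrArg Prod.fst h

lemma HasRightInverse.closedComplemented_ker {E F : Type*}
    [NormedAddCommGroup E] [NormedSpace ℝ E]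
    [NormedAddCommGroup F] [NormedSpace ℝ F] {L : E →L[ℝ] F}
    (h : L.HasRightInverse) : (LinearMap.ker L.toLinearMap).ClosedComplemented := by
  obtain ⟨R, hR⟩ := h
  exact L.closedComplemented_ker_of_rightInverse R hR

end ContinuousLinearMap

section Submersions

variable {M N P : BanachManifold.{u}}

lemma isSurjectiveSubmersion_iff (f : SmoothMap M N) :
    IsSurjectiveSubmersion f ↔
      Function.Surjective f.toFun ∧ ∀ x, (f.tangentMap x).HasRightInverse := by
  constructor
  · rintro ⟨h1, h2, h3⟩
    exact ⟨h1, fun x =>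
      ContinuousLinearMap.hasRightInverse_of_closedComplemented_ker (h2 x) (h3 x)⟩
  · rintro ⟨h1, h2⟩
    exact ⟨h1, fun x => (h2 x).surjective, fun x => (h2 x).closedComplemented_ker⟩

lemma IsSurjectiveSubmersion.comp {f : SmoothMap M N} {g : SmoothMap N P}
    (hf : IsSurjectiveSubmersion f) (hg : IsSurjectiveSubmersion g) :
    IsSurjectiveSubmersion (f.comp g) := by
  rw [isSurjectiveSubmersion_iff] at *
  refine ⟨hg.1.comp hf.1, fun x => ?_⟩
  rw [SmoothMap.tangentMap_comp]
  exact (hg.2 _).comp (hf.2 _)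

lemma IsSurjectiveSubmersion.of_isIso (f : M ⟶ N) [IsIso f] :
    IsSurjectiveSubmersion (f : SmoothMap M N) := by
  rw [isSurjectiveSubmersion_iff]
  have h1 : ∀ y, f.toFun ((inv f).toFun y) = y := fun y =>
    congrArg (fun g : N ⟶ N => SmoothMap.toFun g y) (IsIso.inv_hom_id f)
  refine ⟨fun y => ⟨_, h1 y⟩, fun x => ?_⟩
  -- `T_x f` is a right factor of the identity of `T_{f x} N`, up to the identification
  -- of `f⁻¹ (f x)` with `x`.
  have h2 : ∀ y : N, (SmoothMap.tangentMap f ((inv f).toFun y)).HasRightInverse := fun y => by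
    refine ContinuousLinearMap.HasRightInverse.of_comp
      (f := SmoothMap.tangentMap (inv f : N ⟶ M) y) ?_
    have h3 := SmoothMap.tangentMap_comp (inv f : N ⟶ M) (f : M ⟶ N) y
    rw [← h3]
    have h4 : ∀ g : N ⟶ N, g = 𝟙 N → (SmoothMap.tangentMap g y).HasRightInverse := by
      rintro _ rfl
      exact (ContinuousLinearEquiv.refl ℝ (N.Tangent y)).hasRightInverse.congr
        (SmoothMap.tangentMap_id y)
    exact h4 _ (IsIso.inv_hom_id f)
  have h5 : (inv f).toFun (f.toFun x) = x :=
    congrArg (fun g : M ⟶ M => SmoothMap.toFun g x) (IsIso.hom_inv_id f)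
  have h6 := h2 (f.toFun x)
  rwa [h5] at h6

end Submersions

/-! ### Fibre products along submersions -/

/-- The inverse function theorem, with smoothness of both directions on whole domains. -/
lemma exists_smooth_openPartialHomeomorph {E F : Type*}
    [NormedAddCommGroup E] [NormedSpace ℝ E] [CompleteSpace E]
    [NormedAddCommGroup F] [NormedSpace ℝ F] {ψ : E → F} {x : E} {U : Set E} (hU : U ∈ nhds x)
    (hψ : ∀ y ∈ U, ContDiffAt ℝ ∞ ψ y) (e : E ≃L[ℝ] F) (he : fderiv ℝ ψ x = e) :
    ∃ Φ : OpenPartialHomeomorph E F, x ∈ Φ.source ∧ Φ.source ⊆ U ∧ (Φ : E → F) = ψ ∧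
      ∀ v ∈ Φ.target, ContDiffAt ℝ ∞ Φ.symm v := by
  have hx : ContDiffAt ℝ ∞ ψ x := hψ x (mem_of_mem_nhds hU)
  have hd : HasFDerivAt ψ (e : E →L[ℝ] F) x := he ▸ (hx.differentiableAt (by simp)).hasFDerivAt
  let Φ₀ := hx.toOpenPartialHomeomorph ψ hd (by simp)
  have hx₀ : x ∈ Φ₀.source := hx.mem_toOpenPartialHomeomorph_source hd (by simp)
  -- On a neighbourhood of `x` the derivative of `ψ` stays invertible.
  have hinv : ∀ᶠ y in nhds x, fderiv ℝ ψ y ∈ Set.range ((↑) : (E ≃L[ℝ] F) → E →L[ℝ] F) := by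
    have hc : ContinuousAt (fderiv ℝ ψ) x :=
      (hx.fderiv_right (m := 0) (by simp)).continuousAt
    exact hc (he ▸ e.nhds)
  obtain ⟨V, hVs, hVo, hxV⟩ := mem_nhds_iff.1 (Filter.inter_mem hU hinv)
  refine ⟨Φ₀.restrOpen V hVo, ⟨hx₀, hxV⟩, fun y hy => (hVs hy.2).1, rfl, fun v hv => ?_⟩
  have hv' := (Φ₀.restrOpen V hVo).map_target hv
  obtain ⟨e', he'⟩ := (hVs hv'.2).2
  have hy : ContDiffAt ℝ ∞ ψ ((Φ₀.restrOpen V hVo).symm v) := hψ _ (hVs hv'.2).1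
  refine (Φ₀.restrOpen V hVo).contDiffAt_symm hv (f₀' := e') ?_ hy
  rw [he']
  exact (hy.differentiableAt (by simp)).hasFDerivAt

namespace BanachManifold

/-- A chart around `x` in which the map `p` becomes the first projection of
`T_{p x} N × ker (T_x p)`. -/
structure SubmersionChart {M N : BanachManifold.{u}} (p : SmoothMap M N) (x : M) where
  toChart : OpenPartialHomeomorph M
    (N.model (p x) × LinearMap.ker (p.tangentMap x).toLinearMap)
  mem_source : x ∈ toChart.source
  map_source : ∀ y ∈ toChart.source, p y ∈ (N.chart (p x)).source
  fst_apply : ∀ y ∈ toChart.source, (toChart y).1 = N.chart (p x) (p y)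

instance {M N : BanachManifold.{u}} (p : SmoothMap M N) (x : M) :
    CompleteSpace (LinearMap.ker (p.tangentMap x).toLinearMap) :=
  (p.tangentMap x).isClosed_ker.completeSpace_coe

/-- The compatibility of a submersion chart with the smooth structure. -/
structure SubmersionChart.IsSmooth {M N : BanachManifold.{u}} {p : SmoothMap M N} {x : M}
    (Φ : SubmersionChart p x) : Prop where
  smoothAt : ∀ y ∈ Φ.toChart.source, SmoothAt
    (N := ofBanach (N.model (p x) × LinearMap.ker (p.tangentMap x).toLinearMap)) Φ.toChart y
  smoothAt_symm : ∀ v ∈ Φ.toChart.target, SmoothAt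
    (M := ofBanach (N.model (p x) × LinearMap.ker (p.tangentMap x).toLinearMap)) Φ.toChart.symm v

variable {M N Q : BanachManifold.{u}}

/-- The local normal form of a submersion: complete `p`, in charts, by a projection onto the kernel
of its tangent map and apply the inverse function theorem. -/
lemma exists_submersionChart {p : SmoothMap M N} (hp : IsSurjectiveSubmersion p) (x : M) :
    ∃ Φ : SubmersionChart p x, Φ.IsSmooth := by
  obtain ⟨π, hπ⟩ := hp.ker_complemented x
  let L := p.tangentMap x
  let K := LinearMap.ker L.toLinearMap
  let e := L.equivProdOfSurjectiveOfIsCompl π (LinearMap.range_eq_top.2 (hp.tangent_surjective x))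
    (LinearMap.range_eq_top.2 fun k => ⟨k, hπ k⟩) (LinearMap.isCompl_of_proj hπ)
  let ψ : M.model x → N.model (p x) × K := fun v => (localRep p.toFun x v, π v)
  let U : Set (M.model x) := (M.chart x).target ∩
    (M.chart x).symm ⁻¹' (p.toFun ⁻¹' (N.chart (p x)).source)
  have hUo : IsOpen U := (M.chart x).symm.isOpen_inter_preimage
    ((N.chart (p x)).open_source.preimage p.continuous_toFun)
  have hxU : M.chart x x ∈ U := by
    refine ⟨M.chart_mem_target x, ?_⟩
    simp only [Set.mem_preimage, chart_symm_chart]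
    exact N.mem_source _
  have hψ : ∀ v ∈ U, ContDiffAt ℝ ∞ ψ v := fun v hv => by
    refine ContDiffAt.prodMk ?_ π.contDiff.contDiffAt
    have h := (p.smoothAt ((M.chart x).symm v)).contDiffAt_charts
      ((M.chart x).map_target hv.1) hv.2
    rwa [(M.chart x).right_inv hv.1] at h
  have hd : fderiv ℝ ψ (M.chart x x) = e :=
    ((p.differentiableAt_localRep x).hasFDerivAt.prodMk π.hasFDerivAt).fderiv
  obtain ⟨Φ, hxΦ, hΦU, hΦψ, hΦs⟩ :=
    exists_smooth_openPartialHomeomorph (hUo.mem_nhds hxU) hψ e hd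
  refine ⟨⟨(M.chart x).trans Φ, ?_, ?_, ?_⟩, ?_, ?_⟩
  · rw [OpenPartialHomeomorph.trans_source]
    exact ⟨M.mem_source x, hxΦ⟩
  · intro y hy
    rw [OpenPartialHomeomorph.trans_source] at hy
    have h := (hΦU hy.2).2
    rwa [Set.mem_preimage, (M.chart x).left_inv hy.1] at h
  · intro y hy
    rw [OpenPartialHomeomorph.trans_source] at hy
    have h : Φ (M.chart x y) = ψ (M.chart x y) := congrFun hΦψ _
    rw [OpenPartialHomeomorph.coe_trans, Function.comp_apply, h]
    simp only [ψ, localRep, Function.comp_apply]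
    rw [(M.chart x).left_inv hy.1]
  · intro y hy
    dsimp only at hy ⊢
    rw [OpenPartialHomeomorph.trans_source] at hy
    refine SmoothAt.comp (N := ofBanach (M.model x)) (P := ofBanach (N.model (p x) × K))
      (f := M.chart x) (g := Φ) ?_ (M.smoothAt_chart x hy.1)
    rw [hΦψ]
    exact smoothAt_ofBanach_iff.2 (hψ _ (hΦU hy.2))
  · intro v hv
    dsimp only at hv ⊢
    rw [OpenPartialHomeomorph.trans_target] at hv
    exact SmoothAt.comp (M := ofBanach (N.model (p x) × K)) (N := ofBanach (M.model x))
      (f := Φ.symm) (g := (M.chart x).symm) (M.smoothAt_chart_symm x hv.2)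
      (smoothAt_ofBanach_iff.2 (hΦs v hv.1))

section FibreProduct

/-- The points of the fibre product `M ×_N Q`, with the subspace topology. -/
abbrev FibreProductPoints (p : SmoothMap M N) (g : SmoothMap Q N) : Type u :=
  { z : M × Q // p z.1 = g z.2 }

variable {p : SmoothMap M N} {g : SmoothMap Q N}

/-- The point of `M × Q` with coordinates `(k, q)`: its second component is `q` in the chart around
`z.2`, and the first is determined by the kernel coordinate `k` and by its image in `N`. -/
noncomputable def fibreProductChartInv (z : FibreProductPoints p g)
    (Φ : SubmersionChart p z.1.1)
    (v : LinearMap.ker (p.tangentMap z.1.1).toLinearMap × Q.model z.1.2) : M × Q :=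
  (Φ.toChart.symm (N.chart (p z.1.1) (g ((Q.chart z.1.2).symm v.2)), v.1),
    (Q.chart z.1.2).symm v.2)

/-- The target of the chart of the fibre product around `z`. -/
def fibreProductChartTarget (z : FibreProductPoints p g) (Φ : SubmersionChart p z.1.1) :
    Set (LinearMap.ker (p.tangentMap z.1.1).toLinearMap × Q.model z.1.2) :=
  { v | v.2 ∈ (Q.chart z.1.2).target ∧
    g ((Q.chart z.1.2).symm v.2) ∈ (N.chart (p z.1.1)).source ∧
    (N.chart (p z.1.1) (g ((Q.chart z.1.2).symm v.2)), v.1) ∈ Φ.toChart.target }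

lemma fibreProductChartInv_mem (z : FibreProductPoints p g) (Φ : SubmersionChart p z.1.1)
    {v : LinearMap.ker (p.tangentMap z.1.1).toLinearMap × Q.model z.1.2}
    (hv : v ∈ fibreProductChartTarget z Φ) :
    p (fibreProductChartInv z Φ v).1 = g (fibreProductChartInv z Φ v).2 := by
  obtain ⟨-, h2, h3⟩ := hv
  have h4 := Φ.toChart.map_target h3
  refine (N.chart (p z.1.1)).injOn (Φ.map_source _ h4) h2 ?_
  have h5 := Φ.fst_apply _ h4
  rw [Φ.toChart.right_inv h3] at h5
  exact h5.symm

lemma smoothAt_fibreProductChartInv (z : FibreProductPoints p g) {Φ : SubmersionChart p z.1.1}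
    (hΦ : Φ.IsSmooth) {v : LinearMap.ker (p.tangentMap z.1.1).toLinearMap × Q.model z.1.2}
    (hv : v ∈ fibreProductChartTarget z Φ) :
    SmoothAt (M := ofBanach (LinearMap.ker (p.tangentMap z.1.1).toLinearMap × Q.model z.1.2))
        (fun v => (fibreProductChartInv z Φ v).1) v ∧
      SmoothAt (M := ofBanach (LinearMap.ker (p.tangentMap z.1.1).toLinearMap × Q.model z.1.2))
        (fun v => (fibreProductChartInv z Φ v).2) v := by
  obtain ⟨h1, h2, h3⟩ := hv
  let K := LinearMap.ker (p.tangentMap z.1.1).toLinearMap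
  have hs : SmoothAt (M := ofBanach (K × Q.model z.1.2))
      (fun v => (Q.chart z.1.2).symm v.2) v :=
    SmoothAt.comp (M := ofBanach (K × Q.model z.1.2)) (N := ofBanach (Q.model z.1.2))
      (f := Prod.snd) (g := (Q.chart z.1.2).symm) (Q.smoothAt_chart_symm _ h1)
      (smoothAt_ofBanach_iff.2 contDiffAt_snd)
  refine ⟨?_, hs⟩
  have hg : SmoothAt (M := ofBanach (K × Q.model z.1.2))
      (fun v => g ((Q.chart z.1.2).symm v.2)) v := SmoothAt.comp (g.smoothAt _) hs
  have hn : SmoothAt (M := ofBanach (K × Q.model z.1.2)) (N := ofBanach (N.model (p z.1.1)))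
      (fun v => N.chart (p z.1.1) (g ((Q.chart z.1.2).symm v.2))) v :=
    SmoothAt.comp (M := ofBanach (K × Q.model z.1.2)) (P := ofBanach (N.model (p z.1.1)))
      (f := fun v => g ((Q.chart z.1.2).symm v.2)) (N.smoothAt_chart _ h2) hg
  exact SmoothAt.comp (M := ofBanach (K × Q.model z.1.2))
    (N := ofBanach (N.model (p z.1.1) × K)) (f := fun v =>
      (N.chart (p z.1.1) (g ((Q.chart z.1.2).symm v.2)), v.1)) (g := Φ.toChart.symm)
    (hΦ.smoothAt_symm _ h3)
    (hn.prodMk (g := Prod.fst) (smoothAt_ofBanach_iff.2 contDiffAt_fst))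

open Classical in
/-- The chart of `M ×_N Q` around `z`, with values in `ker (T_{z.1} p) × T_{z.2} Q`. -/
noncomputable def fibreProductChart (z : FibreProductPoints p g) (Φ : SubmersionChart p z.1.1)
    (hΦ : Φ.IsSmooth) : OpenPartialHomeomorph (FibreProductPoints p g)
      (LinearMap.ker (p.tangentMap z.1.1).toLinearMap × Q.model z.1.2) where
  toFun y := ((Φ.toChart y.1.1).2, Q.chart z.1.2 y.1.2)
  -- The value outside the target is irrelevant.
  invFun v := if hv : v ∈ fibreProductChartTarget z Φ then
    ⟨fibreProductChartInv z Φ v, fibreProductChartInv_mem z Φ hv⟩ else z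
  source := { y | y.1.1 ∈ Φ.toChart.source ∧ y.1.2 ∈ (Q.chart z.1.2).source }
  target := fibreProductChartTarget z Φ
  map_source' y hy := by
    have h1 : (Φ.toChart y.1.1).1 = N.chart (p z.1.1) (p y.1.1) := Φ.fst_apply _ hy.1
    refine ⟨(Q.chart z.1.2).map_source hy.2, ?_, ?_⟩
    · rw [(Q.chart z.1.2).left_inv hy.2, ← y.2]
      exact Φ.map_source _ hy.1
    · rw [(Q.chart z.1.2).left_inv hy.2, ← y.2, ← h1]
      exact Φ.toChart.map_source hy.1
  map_target' v hv := by
    rw [dif_pos hv]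
    exact ⟨Φ.toChart.map_target hv.2.2, (Q.chart z.1.2).map_target hv.1⟩
  left_inv' y hy := by
    have h1 : (Φ.toChart y.1.1).1 = N.chart (p z.1.1) (p y.1.1) := Φ.fst_apply _ hy.1
    have h2 : fibreProductChartInv z Φ ((Φ.toChart y.1.1).2, Q.chart z.1.2 y.1.2) = y.1 := by
      simp only [fibreProductChartInv]
      rw [(Q.chart z.1.2).left_inv hy.2, ← y.2, ← h1]
      exact Prod.ext (Φ.toChart.left_inv hy.1) rfl
    have h3 : ((Φ.toChart y.1.1).2, Q.chart z.1.2 y.1.2) ∈ fibreProductChartTarget z Φ := by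
      refine ⟨(Q.chart z.1.2).map_source hy.2, ?_, ?_⟩
      · rw [(Q.chart z.1.2).left_inv hy.2, ← y.2]
        exact Φ.map_source _ hy.1
      · rw [(Q.chart z.1.2).left_inv hy.2, ← y.2, ← h1]
        exact Φ.toChart.map_source hy.1
    rw [dif_pos h3]
    exact Subtype.ext h2
  right_inv' v hv := by
    rw [dif_pos hv]
    refine Prod.ext ?_ ((Q.chart z.1.2).right_inv hv.1)
    exact congrArg Prod.snd (Φ.toChart.right_inv hv.2.2)
  open_source := (Φ.toChart.open_source.preimage (continuous_fst.comp continuous_subtype_val)).inter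
    ((Q.chart z.1.2).open_source.preimage (continuous_snd.comp continuous_subtype_val))
  open_target := by
    have h1 : IsOpen {v : LinearMap.ker (p.tangentMap z.1.1).toLinearMap × Q.model z.1.2 |
        v.2 ∈ (Q.chart z.1.2).target ∩ (Q.chart z.1.2).symm ⁻¹'
          (g.toFun ⁻¹' (N.chart (p z.1.1)).source)} :=
      ((Q.chart z.1.2).symm.isOpen_inter_preimage
        ((N.chart (p z.1.1)).open_source.preimage g.continuous_toFun)).preimage continuous_snd
    have h2 : ContinuousOn
        (fun v : LinearMap.ker (p.tangentMap z.1.1).toLinearMap × Q.model z.1.2 =>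
          (N.chart (p z.1.1) (g ((Q.chart z.1.2).symm v.2)), v.1))
        {v | v.2 ∈ (Q.chart z.1.2).target ∩ (Q.chart z.1.2).symm ⁻¹'
          (g.toFun ⁻¹' (N.chart (p z.1.1)).source)} := by
      refine ContinuousOn.prodMk ?_ continuousOn_fst
      refine (N.chart (p z.1.1)).continuousOn.comp
        (g.continuous_toFun.comp_continuousOn ?_) fun v hv => hv.2
      exact (Q.chart z.1.2).symm.continuousOn.comp continuousOn_snd fun v hv => hv.1
    have h3 := h2.isOpen_inter_preimage h1 Φ.toChart.open_target
    convert! h3 using 1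
    ext v
    simp only [fibreProductChartTarget, Set.mem_ofPred_eq, Set.mem_inter_iff, Set.mem_preimage,
      and_assoc]
  continuousOn_toFun := by
    refine ContinuousOn.prodMk (continuous_snd.comp_continuousOn ?_) ?_
    · exact Φ.toChart.continuousOn.comp
        (continuous_fst.comp continuous_subtype_val).continuousOn fun y hy => hy.1
    · exact (Q.chart z.1.2).continuousOn.comp
        (continuous_snd.comp continuous_subtype_val).continuousOn fun y hy => hy.2
  continuousOn_invFun := by
    refine Topology.IsInducing.subtypeVal.continuousOn_iff.2 ?_
    have h : ContinuousOn (fibreProductChartInv z Φ) (fibreProductChartTarget z Φ) := fun v hv =>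
      have hs := smoothAt_fibreProductChartInv z hΦ hv
      (hs.1.continuousAt.prodMk hs.2.continuousAt).continuousWithinAt
    refine h.congr fun v hv => ?_
    simp only [Function.comp_apply]
    rw [dif_pos hv]

variable (p g) in
lemma fibreProductChart_symm_apply (z : FibreProductPoints p g) (Φ : SubmersionChart p z.1.1)
    (hΦ : Φ.IsSmooth) {v : LinearMap.ker (p.tangentMap z.1.1).toLinearMap × Q.model z.1.2}
    (hv : v ∈ (fibreProductChart z Φ hΦ).target) :
    ((fibreProductChart z Φ hΦ).symm v).1 = fibreProductChartInv z Φ v := by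
  have h : (fibreProductChart z Φ hΦ).symm v =
      ⟨fibreProductChartInv z Φ v, fibreProductChartInv_mem z Φ hv⟩ := dif_pos hv
  rw [h]

lemma smoothAt_fibreProductChart {T : BanachManifold.{u}} (z : FibreProductPoints p g)
    {Φ : SubmersionChart p z.1.1} (hΦ : Φ.IsSmooth) {f : T → FibreProductPoints p g} {t : T}
    (hf : f t ∈ (fibreProductChart z Φ hΦ).source)
    (h1 : SmoothAt (fun t => (f t).1.1) t) (h2 : SmoothAt (fun t => (f t).1.2) t) :
    SmoothAt
      (N := ofBanach (LinearMap.ker (p.tangentMap z.1.1).toLinearMap × Q.model z.1.2))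
      (fun t => fibreProductChart z Φ hΦ (f t)) t := by
  let K := LinearMap.ker (p.tangentMap z.1.1).toLinearMap
  have h3 : SmoothAt (N := ofBanach (N.model (p z.1.1) × K))
      (fun t => Φ.toChart (f t).1.1) t :=
    SmoothAt.comp (P := ofBanach (N.model (p z.1.1) × K)) (g := Φ.toChart)
      (hΦ.smoothAt _ hf.1) h1
  have h4 : SmoothAt (N := ofBanach (Q.model z.1.2)) (fun t => Q.chart z.1.2 (f t).1.2) t :=
    SmoothAt.comp (P := ofBanach (Q.model z.1.2)) (g := Q.chart z.1.2)
      (Q.smoothAt_chart _ hf.2) h2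
  exact h3.snd.prodMk h4

/-- The fibre product `M ×_N Q` along a surjective submersion `p : M → N`. -/
noncomputable def fibreProduct (hp : IsSurjectiveSubmersion p) (g : SmoothMap Q N) :
    BanachManifold.{u} where
  carrier := FibreProductPoints p g
  model z := LinearMap.ker (p.tangentMap z.1.1).toLinearMap × Q.model z.1.2
  chart z := fibreProductChart z (exists_submersionChart hp z.1.1).choose
    (exists_submersionChart hp z.1.1).choose_spec
  mem_source z := ⟨(exists_submersionChart hp z.1.1).choose.mem_source, Q.mem_source _⟩
  transition x y := by
    intro v hv
    refine ContDiffAt.contDiffWithinAt ?_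
    rw [OpenPartialHomeomorph.trans_source] at hv
    have hx := (exists_submersionChart hp x.1.1).choose_spec
    have hy := (exists_submersionChart hp y.1.1).choose_spec
    have hs := smoothAt_fibreProductChartInv x hx hv.1
    have ht : ∀ᶠ w in nhds v, w ∈ (fibreProductChart x _ hx).target :=
      (fibreProductChart x _ hx).open_target.mem_nhds hv.1
    have h1 := smoothAt_fibreProductChart (T := ofBanach
      (LinearMap.ker (p.tangentMap x.1.1).toLinearMap × Q.model x.1.2)) y hy
      (f := (fibreProductChart x _ hx).symm) (t := v) hv.2
      (hs.1.congr (ht.mono fun w hw => congrArg Prod.fst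
        (fibreProductChart_symm_apply p g x _ hx hw)))
      (hs.2.congr (ht.mono fun w hw => congrArg Prod.snd
        (fibreProductChart_symm_apply p g x _ hx hw)))
    exact smoothAt_ofBanach_iff.1 h1

variable (hp : IsSurjectiveSubmersion p) (g)

lemma smoothAt_fibreProduct_symm (z : fibreProduct hp g) :
    SmoothAt (M := ofBanach ((fibreProduct hp g).model z))
        (fun v => (((fibreProduct hp g).chart z).symm v).1.1) ((fibreProduct hp g).chart z z) ∧
      SmoothAt (M := ofBanach ((fibreProduct hp g).model z))
        (fun v => (((fibreProduct hp g).chart z).symm v).1.2) ((fibreProduct hp g).chart z z) := by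
  have hz := (exists_submersionChart hp z.1.1).choose_spec
  have ht := (fibreProduct hp g).chart_mem_target z
  have hs := smoothAt_fibreProductChartInv z hz ht
  have ht' : ∀ᶠ w in nhds ((fibreProduct hp g).chart z z), w ∈ (fibreProductChart z _ hz).target :=
    (fibreProductChart z _ hz).open_target.mem_nhds ht
  exact ⟨hs.1.congr (ht'.mono fun w hw => congrArg Prod.fst
      (fibreProductChart_symm_apply p g z _ hz hw)),
    hs.2.congr (ht'.mono fun w hw => congrArg Prod.snd
      (fibreProductChart_symm_apply p g z _ hz hw))⟩

/-- The projection `M ×_N Q → M`. -/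
noncomputable def fibreProductFst : SmoothMap (fibreProduct hp g) M where
  toFun z := z.1.1
  continuous_toFun := continuous_fst.comp continuous_subtype_val
  smooth_toFun z := (SmoothAt.of_comp_chart_symm (M := fibreProduct hp g) (f := fun z => z.1.1)
    (smoothAt_fibreProduct_symm g hp z).1).contDiffAt

/-- The projection `M ×_N Q → Q`. -/
noncomputable def fibreProductSnd : SmoothMap (fibreProduct hp g) Q where
  toFun z := z.1.2
  continuous_toFun := continuous_snd.comp continuous_subtype_val
  smooth_toFun z := (SmoothAt.of_comp_chart_symm (M := fibreProduct hp g) (f := fun z => z.1.2)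
    (smoothAt_fibreProduct_symm g hp z).2).contDiffAt

variable {g} in
/-- The map to `M ×_N Q` with components `a` and `b`. -/
noncomputable def fibreProductLift {T : BanachManifold.{u}} (a : SmoothMap T M) (b : SmoothMap T Q)
    (h : ∀ t, p (a t) = g (b t)) : SmoothMap T (fibreProduct hp g) where
  toFun t := ⟨(a t, b t), h t⟩
  continuous_toFun := (a.continuous_toFun.prodMk b.continuous_toFun).subtype_mk _
  smooth_toFun t := by
    refine (SmoothAt.of_chart_comp (N := fibreProduct hp g) (f := fun t => ⟨(a t, b t), h t⟩)
      ((a.continuous_toFun.prodMk b.continuous_toFun).subtype_mk _).continuousAt ?_).contDiffAt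
    exact smoothAt_fibreProductChart _ (exists_submersionChart hp _).choose_spec
      (f := fun t => ⟨(a t, b t), h t⟩)
      ((fibreProduct hp g).mem_source ⟨(a t, b t), h t⟩) (a.smoothAt t) (b.smoothAt t)

/-- In the charts of the fibre product, the projection to `Q` is a linear projection. -/
lemma isSurjectiveSubmersion_fibreProductSnd :
    IsSurjectiveSubmersion (fibreProductSnd g hp) := by
  rw [isSurjectiveSubmersion_iff]
  refine ⟨fun y => ?_, fun z => ?_⟩
  · obtain ⟨x, hx⟩ := hp.surjective (g y)
    exact ⟨⟨(x, y), hx⟩, rfl⟩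
  · have h : localRep (fibreProductSnd g hp).toFun z =ᶠ[nhds ((fibreProduct hp g).chart z z)]
        Prod.snd := by
      filter_upwards [((fibreProduct hp g).chart z).open_target.mem_nhds
        ((fibreProduct hp g).chart_mem_target z)] with v hv
      have h1 := fibreProductChart_symm_apply p g z _ (exists_submersionChart hp z.1.1).choose_spec
        hv
      exact (congrArg (fun w : M × Q => Q.chart z.1.2 w.2) h1).trans
        ((Q.chart z.1.2).right_inv hv.1)
    exact (ContinuousLinearMap.HasRightInverse.snd (R := ℝ)
      (F := LinearMap.ker (p.tangentMap z.1.1).toLinearMap)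
      (G := Q.model z.1.2)).congr (h.fderiv_eq.trans fderiv_snd)

lemma isPullback_fibreProduct :
    IsPullback (P := fibreProduct hp g) (X := M) (Y := Q) (Z := N)
      (fibreProductFst g hp) (fibreProductSnd g hp) p g := by
  have hw : CategoryStruct.comp (X := fibreProduct hp g) (Y := M) (Z := N)
      (fibreProductFst g hp) p =
      CategoryStruct.comp (X := fibreProduct hp g) (Y := Q) (Z := N) (fibreProductSnd g hp) g :=
    SmoothMap.ext (funext fun z => z.2)
  refine ⟨⟨hw⟩, ⟨Limits.PullbackCone.IsLimit.mk hw
    (fun s => fibreProductLift hp s.fst s.snd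
      fun t => congrArg (fun f : s.pt ⟶ N => SmoothMap.toFun f t) s.condition)
    (fun s => rfl) (fun s => rfl) fun s m h1 h2 => ?_⟩⟩
  refine SmoothMap.ext (funext fun t => Subtype.ext (Prod.ext ?_ ?_))
  · exact congrArg (fun f : s.pt ⟶ M => SmoothMap.toFun f t) h1
  · exact congrArg (fun f : s.pt ⟶ Q => SmoothMap.toFun f t) h2

end FibreProduct

end BanachManifold

/-! ### Pullback and the de Rham differential of forms -/

namespace ContinuousAlternatingMap

variable {E F : Type*} [NormedAddCommGroup E] [NormedSpace ℝ E]
  [NormedAddCommGroup F] [NormedSpace ℝ F] {q : ℕ}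

/-- The normalised antisymmetrisation, a continuous linear retraction of the inclusion of the
alternating maps into the multilinear maps. -/
noncomputable def antisymmetrization :
    ContinuousMultilinearMap ℝ (fun _ : Fin q => E) ℝ →L[ℝ] E [⋀^Fin q]→L[ℝ] ℝ :=
  LinearMap.mkContinuous
    { toFun := fun f => (q.factorial : ℝ)⁻¹ • ContinuousMultilinearMap.alternatization f
      map_add' := fun f g => by rw [map_add, smul_add]
      map_smul' := fun c f => by
        ext v
        simp only [ContinuousAlternatingMap.smul_apply,
          ContinuousMultilinearMap.alternatization_apply_apply, _root_.smul_apply,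
          RingHom.id_apply, smul_eq_mul, Finset.mul_sum]
        refine Finset.sum_congr rfl fun σ _ => ?_
        rw [mul_smul_comm, mul_smul_comm, mul_smul_comm]
        congr 1
        ring }
    1 fun f => by
      refine ContinuousAlternatingMap.opNorm_le_bound _ (by positivity) fun v => ?_
      have h : ‖ContinuousMultilinearMap.alternatization f v‖ ≤
          q.factorial * (‖f‖ * ∏ i, ‖v i‖) := by
        rw [ContinuousMultilinearMap.alternatization_apply_apply]
        refine (norm_sum_le _ _).trans ?_
        have h1 : ∀ σ ∈ (Finset.univ : Finset (Equiv.Perm (Fin q))),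
            ‖Equiv.Perm.sign σ • f (v ∘ σ)‖ ≤ ‖f‖ * ∏ i, ‖v i‖ := fun σ _ => by
          have h2 := f.le_opNorm (v ∘ σ)
          have h3 : ∏ i, ‖(v ∘ σ) i‖ = ∏ i, ‖v i‖ := Equiv.prod_comp σ fun i => ‖v i‖
          rw [h3] at h2
          rcases Int.units_eq_one_or (Equiv.Perm.sign σ) with h | h <;> simpa [h] using h2
        refine (Finset.sum_le_card_nsmul _ _ _ h1).trans_eq ?_
        rw [Finset.card_univ, Fintype.card_perm, Fintype.card_fin, nsmul_eq_mul]
      have hq : (0 : ℝ) < q.factorial := by positivity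
      calc ‖(q.factorial : ℝ)⁻¹ * ContinuousMultilinearMap.alternatization f v‖
          = (q.factorial : ℝ)⁻¹ * ‖ContinuousMultilinearMap.alternatization f v‖ := by
            rw [norm_mul, norm_inv, Real.norm_natCast]
        _ ≤ (q.factorial : ℝ)⁻¹ * (q.factorial * (‖f‖ * ∏ i, ‖v i‖)) := by gcongr
        _ = 1 * ‖f‖ * ∏ i, ‖v i‖ := by field_simp

lemma antisymmetrization_toContinuousMultilinearMap (f : E [⋀^Fin q]→L[ℝ] ℝ) :
    antisymmetrization f.toContinuousMultilinearMap = f := by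
  ext v
  have h : ContinuousMultilinearMap.alternatization f.toContinuousMultilinearMap v =
      q.factorial * f v := by
    rw [ContinuousMultilinearMap.alternatization_apply_apply]
    have h1 : ∀ σ : Equiv.Perm (Fin q),
        Equiv.Perm.sign σ • f.toContinuousMultilinearMap (v ∘ σ) = f v := fun σ => by
      have h2 : f.toContinuousMultilinearMap (v ∘ σ) = Equiv.Perm.sign σ • f v :=
        f.toAlternatingMap.map_perm v σ
      rw [h2, smul_smul, Int.units_mul_self, one_smul]
    rw [Finset.sum_congr rfl fun σ _ => h1 σ, Finset.sum_const, Finset.card_univ,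
      Fintype.card_perm, Fintype.card_fin, nsmul_eq_mul]
  have hq : (q.factorial : ℝ) ≠ 0 := by positivity
  change (q.factorial : ℝ)⁻¹ * ContinuousMultilinearMap.alternatization
    f.toContinuousMultilinearMap v = f v
  rw [h]
  field_simp

/-- The pullback of an alternating form along a linear map is smooth in both, as it is the
antisymmetrisation of an expression that is multilinear in finitely many copies. -/
lemma contDiff_compContinuousLinearMap :
    ContDiff ℝ ∞ fun z : (F [⋀^Fin q]→L[ℝ] ℝ) × (E →L[ℝ] F) =>
      z.1.compContinuousLinearMap z.2 := by
  have h1 : ContDiff ℝ ∞ fun z : (F [⋀^Fin q]→L[ℝ] ℝ) × (E →L[ℝ] F) =>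
      ContinuousMultilinearMap.compContinuousLinearMapContinuousMultilinear ℝ
        (fun _ : Fin q => E) (fun _ : Fin q => F) ℝ (fun _ => z.2)
        (toContinuousMultilinearMapCLM ℝ z.1) := by
    refine ContDiff.clm_apply ?_ ?_
    · refine (ContinuousMultilinearMap.contDiff _).comp ?_
      exact contDiff_pi.2 fun _ => contDiff_snd
    · exact (ContinuousLinearMap.contDiff _).comp contDiff_fst
  have h2 := (antisymmetrization (E := E) (q := q)).contDiff (n := ∞) |>.comp h1
  convert! h2 using 1
  funext z
  exact (antisymmetrization_toContinuousMultilinearMap _).symm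

end ContinuousAlternatingMap

namespace DiffForm

variable {M N P : BanachManifold.{u}} {q : ℕ}

section Linear

variable (f : SmoothMap M N)

@[simp] lemma pullback_zero : pullback f (0 : DiffForm N q) = 0 := by
  funext x; ext v; rfl

lemma pullback_add (η θ : DiffForm N q) : pullback f (η + θ) = pullback f η + pullback f θ := by
  funext x; ext v; rfl

lemma pullback_sub (η θ : DiffForm N q) : pullback f (η - θ) = pullback f η - pullback f θ := by
  funext x; ext v; rfl

lemma pullback_smul (c : ℝ) (η : DiffForm N q) : pullback f (c • η) = c • pullback f η := by
  funext x; ext v; rfl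

lemma pullback_sum {ι : Type*} (s : Finset ι) (η : ι → DiffForm N q) :
    pullback f (∑ i ∈ s, η i) = ∑ i ∈ s, pullback f (η i) := by
  classical
  induction s using Finset.induction_on with
  | empty => simp
  | insert i s hi ih => rw [Finset.sum_insert hi, Finset.sum_insert hi, pullback_add, ih]

end Linear

lemma pullback_comp (f : M ⟶ N) (g : N ⟶ P) (η : DiffForm P q) :
    pullback (f ≫ g) η = pullback f (pullback g η) := by
  funext x
  have h : SmoothMap.tangentMap (f ≫ g) x = (SmoothMap.tangentMap g (f.toFun x)).comp
      (SmoothMap.tangentMap f x) := SmoothMap.tangentMap_comp f g x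
  ext v
  exact congrArg (fun L : M.Tangent x →L[ℝ] P.Tangent (g.toFun (f.toFun x)) =>
    η (g.toFun (f.toFun x)) (fun i => L (v i))) h

/-- The chart expression of a form, at a point given by its position on the manifold. -/
lemma inChart_chart (η : DiffForm M q) {a z : M} (hz : z ∈ (M.chart a).source) :
    η.inChart a (M.chart a z) = (η z).compContinuousLinearMap
      (fderiv ℝ (M.chart z ∘ (M.chart a).symm) (M.chart a z)) := by
  have key : ∀ z', z' = z → (η z').compContinuousLinearMap
      (fderiv ℝ (M.chart z' ∘ (M.chart a).symm) (M.chart a z)) =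
      (η z).compContinuousLinearMap
      (fderiv ℝ (M.chart z ∘ (M.chart a).symm) (M.chart a z)) := by
    rintro _ rfl
    rfl
  exact key _ ((M.chart a).left_inv hz)

/-- In charts, the pullback of forms is the pullback along the local expression of the map. -/
lemma inChart_pullback (f : SmoothMap M N) (η : DiffForm N q) (x : M) :
    (pullback f η).inChart x =ᶠ[nhds (M.chart x x)] fun v =>
      (η.inChart (f x) (localRep f.toFun x v)).compContinuousLinearMap
        (fderiv ℝ (localRep f.toFun x) v) := by
  have hU : IsOpen ((M.chart x).target ∩
      (M.chart x).symm ⁻¹' (f.toFun ⁻¹' (N.chart (f x)).source)) :=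
    (M.chart x).symm.isOpen_inter_preimage
      ((N.chart (f x)).open_source.preimage f.continuous_toFun)
  have hx : M.chart x x ∈ (M.chart x).target ∩
      (M.chart x).symm ⁻¹' (f.toFun ⁻¹' (N.chart (f x)).source) :=
    ⟨M.chart_mem_target x, by simpa using N.mem_source _⟩
  filter_upwards [hU.mem_nhds hx] with v hv
  obtain ⟨y, hy, rfl⟩ : ∃ y ∈ (M.chart x).source, M.chart x y = v :=
    ⟨_, (M.chart x).map_target hv.1, (M.chart x).right_inv hv.1⟩
  have hyx : (M.chart x).symm (M.chart x y) = y := (M.chart x).left_inv hy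
  have hfy : f y ∈ (N.chart (f x)).source := by
    have := hv.2
    rwa [Set.mem_preimage, hyx] at this
  have hF : localRep f.toFun x (M.chart x y) = N.chart (f x) (f y) := by
    simp only [localRep, Function.comp_apply, hyx]
  rw [inChart_chart _ hy, hF, inChart_chart _ hfy]
  -- Both linear maps are the derivative of `f` read in the charts around `x` and `f y`.
  have h1 : fderiv ℝ (fun w => N.chart (f y) (f ((M.chart x).symm w))) (M.chart x y) =
      (f.tangentMap y).comp (fderiv ℝ (M.chart y ∘ (M.chart x).symm) (M.chart x y)) := by
    have ht := (M.contDiffAt_transition x y hy (M.mem_source y)).differentiableAt (by simp)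
    have hyy : (M.chart y ∘ (M.chart x).symm) (M.chart x y) = M.chart y y := by
      simp only [Function.comp_apply, hyx]
    have hloc : (fun w => N.chart (f y) (f ((M.chart x).symm w))) =ᶠ[nhds (M.chart x y)]
        localRep f.toFun y ∘ (M.chart y ∘ (M.chart x).symm) := by
      have hc : ContinuousAt (M.chart x).symm (M.chart x y) :=
        (M.chart x).symm.continuousAt ((M.chart x).map_source hy)
      have hs : (M.chart y).source ∈ nhds ((M.chart x).symm (M.chart x y)) := by
        rw [hyx]
        exact (M.chart y).open_source.mem_nhds (M.mem_source y)
      filter_upwards [hc hs] with w hw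
      simp only [localRep, Function.comp_apply]
      rw [(M.chart y).left_inv hw]
    rw [hloc.fderiv_eq, fderiv_comp _ (by rw [hyy]; exact f.differentiableAt_localRep y) ht, hyy]
    rfl
  have h2 : fderiv ℝ (fun w => N.chart (f y) (f ((M.chart x).symm w))) (M.chart x y) =
      (fderiv ℝ (N.chart (f y) ∘ (N.chart (f x)).symm) (N.chart (f x) (f y))).comp
        (fderiv ℝ (localRep f.toFun x) (M.chart x y)) := by
    have ht := (N.contDiffAt_transition (f x) (f y) hfy (N.mem_source _)).differentiableAt
      (by simp)
    have hd : DifferentiableAt ℝ (localRep f.toFun x) (M.chart x y) :=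
      ((f.smoothAt y).contDiffAt_charts hy hfy).differentiableAt (by simp)
    have hloc : (fun w => N.chart (f y) (f ((M.chart x).symm w))) =ᶠ[nhds (M.chart x y)]
        (N.chart (f y) ∘ (N.chart (f x)).symm) ∘ localRep f.toFun x := by
      filter_upwards [hU.mem_nhds hv] with w hw
      simp only [localRep, Function.comp_apply]
      rw [(N.chart (f x)).left_inv hw.2]
    rw [hloc.fderiv_eq, fderiv_comp _ (by rw [hF]; exact ht) hd, hF]
  have h3 := h1.symm.trans h2
  ext w
  exact congrArg (fun L : M.model x →L[ℝ] N.model (f y) => η (f y) (fun i => L (w i))) h3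

lemma IsSmooth.pullback {η : DiffForm N q} (hη : η.IsSmooth) (f : SmoothMap M N) :
    (DiffForm.pullback f η).IsSmooth := fun x => by
  refine ContDiffAt.congr_of_eventuallyEq ?_ (inChart_pullback f η x)
  have h1 : ContDiffAt ℝ ∞ (fun v => η.inChart (f x) (localRep f.toFun x v)) (M.chart x x) := by
    have h0 : ContDiffAt ℝ ∞ (η.inChart (f x)) (localRep f.toFun x (M.chart x x)) := by
      rw [localRep_chart]
      exact hη _
    exact h0.comp _ (f.smooth_toFun x)
  have h2 : ContDiffAt ℝ ∞ (fderiv ℝ (localRep f.toFun x)) (M.chart x x) :=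
    (f.smooth_toFun x).fderiv_right (by simp)
  have h3 := ContinuousAlternatingMap.contDiff_compContinuousLinearMap
    (E := M.model x) (F := N.model (f x)) (q := q)
  exact h3.contDiffAt.comp (M.chart x x) (h1.prodMk h2)

lemma d_pullback {η : DiffForm N q} (hη : η.IsSmooth) (f : SmoothMap M N) :
    d (pullback f η) = pullback f (d η) := by
  funext x
  have hd : DifferentiableAt ℝ (η.inChart (f x)) (localRep f.toFun x (M.chart x x)) := by
    rw [localRep_chart]
    exact (hη _).differentiableAt (by simp)
  refine (inChart_pullback f η x).extDeriv_eq.trans ?_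
  rw [extDeriv_pullback hd (f.smooth_toFun x)
    (by rw [minSmoothness_of_isRCLikeNormedField]; exact WithTop.coe_le_coe.2 le_top),
    localRep_chart]
  rfl

lemma inChart_add (η θ : DiffForm M q) (x : M) :
    (η + θ).inChart x = η.inChart x + θ.inChart x := by
  funext v; ext w; rfl

lemma inChart_smul (c : ℝ) (η : DiffForm M q) (x : M) :
    (c • η).inChart x = c • η.inChart x := by
  funext v; ext w; rfl

lemma IsSmooth.add {η θ : DiffForm M q} (hη : η.IsSmooth) (hθ : θ.IsSmooth) :
    (η + θ).IsSmooth := fun x => by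
  rw [inChart_add]
  exact (hη x).add (hθ x)

lemma IsSmooth.smul (c : ℝ) {η : DiffForm M q} (hη : η.IsSmooth) : (c • η).IsSmooth := fun x => by
  rw [inChart_smul]
  exact contDiffAt_const.smul (hη x)

lemma isSmooth_zero : (0 : DiffForm M q).IsSmooth := fun x => by
  have h : (0 : DiffForm M q).inChart x = fun _ => 0 := by
    funext v; ext w; rfl
  rw [h]
  exact contDiffAt_const

lemma d_add {η θ : DiffForm M q} (hη : η.IsSmooth) (hθ : θ.IsSmooth) :
    d (η + θ) = d η + d θ := by
  funext x
  rw [Pi.add_apply, d, inChart_add]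
  exact extDeriv_add ((hη x).differentiableAt (by simp)) ((hθ x).differentiableAt (by simp))

lemma d_smul (c : ℝ) (η : DiffForm M q) : d (c • η) = c • d η := by
  funext x
  rw [Pi.smul_apply, d, inChart_smul]
  exact extDeriv_smul c _

end DiffForm

/-! ### The total differential -/

namespace DoubleForm

variable {X Y Z : SimplicialManifold.{u}}

lemma pullback_add (f : X ⟶ Y) (α β : DoubleForm Y) :
    pullback f (α + β) = pullback f α + pullback f β :=
  funext fun _ => funext fun _ => DiffForm.pullback_add _ _ _

lemma pullback_sub (f : X ⟶ Y) (α β : DoubleForm Y) :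
    pullback f (α - β) = pullback f α - pullback f β :=
  funext fun _ => funext fun _ => DiffForm.pullback_sub _ _ _

lemma pullback_comp (f : X ⟶ Y) (g : Y ⟶ Z) (α : DoubleForm Z) :
    pullback (f ≫ g) α = pullback f (pullback g α) :=
  funext fun _ => funext fun _ => DiffForm.pullback_comp _ _ _

lemma simplicialDiff_pullback (f : X ⟶ Y) {p q : ℕ} (η : DiffForm (Y.level p) q) :
    simplicialDiff (DiffForm.pullback (f.app (op (SimplexCategory.mk p))) η) =
      DiffForm.pullback (f.app (op (SimplexCategory.mk (p + 1)))) (simplicialDiff η) := by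
  rw [simplicialDiff, simplicialDiff, DiffForm.pullback_sum]
  refine Finset.sum_congr rfl fun i _ => ?_
  rw [DiffForm.pullback_smul, ← DiffForm.pullback_comp, ← DiffForm.pullback_comp]
  congr 2
  exact f.naturality (SimplexCategory.δ i).op

lemma D_pullback (f : X ⟶ Y) {α : DoubleForm Y} (hα : ∀ p q, (α p q).IsSmooth) :
    (pullback f α).D = pullback f α.D := by
  have h1 : (pullback f α).deltaPart = pullback f α.deltaPart := by
    funext p q
    cases p with
    | zero => exact (DiffForm.pullback_zero _).symm
    | succ p => exact simplicialDiff_pullback f _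
  have h2 : (pullback f α).deRhamPart = pullback f α.deRhamPart := by
    funext p q
    cases q with
    | zero => exact (DiffForm.pullback_zero _).symm
    | succ q =>
      refine Eq.trans ?_ (DiffForm.pullback_smul _ _ _).symm
      exact congrArg (fun θ => (-1 : ℝ) ^ p • θ) (DiffForm.d_pullback (hα p q) _)
  rw [D, D, h1, h2, pullback_add]

lemma D_add {α β : DoubleForm X} (hα : ∀ p q, (α p q).IsSmooth) (hβ : ∀ p q, (β p q).IsSmooth) :
    (α + β).D = α.D + β.D := by
  have h1 : (α + β).deltaPart = α.deltaPart + β.deltaPart := by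
    funext p q
    cases p with
    | zero => exact (add_zero _).symm
    | succ p =>
      simp only [deltaPart, Pi.add_apply, simplicialDiff, DiffForm.pullback_add, smul_add,
        Finset.sum_add_distrib]
  have h2 : (α + β).deRhamPart = α.deRhamPart + β.deRhamPart := by
    funext p q
    cases q with
    | zero => exact (add_zero _).symm
    | succ q => simp only [deRhamPart, Pi.add_apply, DiffForm.d_add (hα p q) (hβ p q), smul_add]
  rw [D, D, D, h1, h2]
  abel

lemma D_smul (c : ℝ) (α : DoubleForm X) : (c • α).D = c • α.D := by
  have h1 : (c • α).deltaPart = c • α.deltaPart := by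
    funext p q
    cases p with
    | zero => exact (smul_zero c).symm
    | succ p =>
      simp only [deltaPart, Pi.smul_apply, simplicialDiff, DiffForm.pullback_smul,
        Finset.smul_sum, smul_comm c]
  have h2 : (c • α).deRhamPart = c • α.deRhamPart := by
    funext p q
    cases q with
    | zero => exact (smul_zero c).symm
    | succ q => simp only [deRhamPart, Pi.smul_apply, DiffForm.d_smul, smul_comm c]
  rw [D, D, h1, h2, smul_add]

lemma D_zero : (0 : DoubleForm X).D = 0 := by
  simpa using D_smul 0 (0 : DoubleForm X)

namespace IsShifted

variable {m : ℤ} {k : ℕ}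

lemma zero : (0 : DoubleForm X).IsShifted m k where
  smooth _ _ := DiffForm.isSmooth_zero
  eq_zero _ _ _ := rfl
  normalised _ _ _ := DiffForm.pullback_zero _

lemma add {α β : DoubleForm X} (hα : α.IsShifted m k) (hβ : β.IsShifted m k) :
    (α + β).IsShifted m k where
  smooth p q := (hα.smooth p q).add (hβ.smooth p q)
  eq_zero p q h := by rw [Pi.add_apply, Pi.add_apply, hα.eq_zero p q h, hβ.eq_zero p q h, add_zero]
  normalised p q i := by
    rw [Pi.add_apply, Pi.add_apply, DiffForm.pullback_add, hα.normalised, hβ.normalised, add_zero]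

lemma smul (c : ℝ) {α : DoubleForm X} (hα : α.IsShifted m k) : (c • α).IsShifted m k where
  smooth p q := (hα.smooth p q).smul c
  eq_zero p q h := by rw [Pi.smul_apply, Pi.smul_apply, hα.eq_zero p q h, smul_zero]
  normalised p q i := by
    rw [Pi.smul_apply, Pi.smul_apply, DiffForm.pullback_smul, hα.normalised, smul_zero]

lemma pullback {α : DoubleForm Y} (hα : α.IsShifted m k) (f : X ⟶ Y) :
    (DoubleForm.pullback f α).IsShifted m k where
  smooth p q := (hα.smooth p q).pullback _
  eq_zero p q h := by rw [DoubleForm.pullback, hα.eq_zero p q h, DiffForm.pullback_zero]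
  normalised p q i := by
    have h : X.σ i ≫ f.app (op (SimplexCategory.mk (p + 1))) =
        f.app (op (SimplexCategory.mk p)) ≫ Y.σ i := f.naturality (SimplexCategory.σ i).op
    rw [DoubleForm.pullback, ← DiffForm.pullback_comp, h, DiffForm.pullback_comp, hα.normalised,
      DiffForm.pullback_zero]

end IsShifted

end DoubleForm

/-! ### Simplicial sets: attaching cells, and unique fillers -/

namespace SSet

open Simplicial

/-- Attaching to a subcomplex `A` of a nonsingular simplicial set a nondegenerate simplex `x` that
is not in `A` but whose boundary is: `A` meets the simplex generated by `x`, which is a copy of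
`Δ[d]`, exactly in the copy of `∂Δ[d]`. -/
lemma isPushout_attachSimplex {X : SSet.{u}} [X.Nonsingular] (A : X.Subcomplex) {d : ℕ}
    (x : X _⦋d⦌) (hx : x ∈ X.nonDegenerate d)
    (hA : A.preimage (yonedaEquiv.symm x) = ∂Δ[d]) :
    ∃ t : (∂Δ[d] : SSet.{u}) ⟶ A, ∃ b : Δ[d] ⟶ (A ⊔ Subcomplex.ofSimplex x : X.Subcomplex),
      IsPushout t ∂Δ[d].ι (Subcomplex.homOfLE le_sup_left) b := by
  have hx' := Nonsingular.mono' x hx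
  have hmem : ∀ {n : SimplexCategoryᵒᵖ} (s : Δ[d].obj n),
      s ∈ ∂Δ[d].obj n ↔ (yonedaEquiv.symm x).app n s ∈ A.obj n := fun {n} s => by
    rw [← hA]
    rfl
  let t₀ : (∂Δ[d] : SSet.{u}) ⟶ (A ⊓ Subcomplex.ofSimplex x : X.Subcomplex) :=
    Subcomplex.lift (∂Δ[d].ι ≫ yonedaEquiv.symm x) (by
      rintro n _ ⟨s, rfl⟩
      exact ⟨(hmem s.1).1 s.2, ((Subcomplex.toOfSimplex x).app n s.1).2⟩)
  have ht₀ : IsIso t₀ := by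
    have : ∀ n, IsIso (t₀.app n) := fun n => by
      rw [isIso_iff_bijective]
      constructor
      · intro s s' h
        have h1 : (yonedaEquiv.symm x).app n s.1 = (yonedaEquiv.symm x).app n s'.1 :=
          congrArg Subtype.val h
        exact Subtype.ext (injective_of_mono ((yonedaEquiv.symm x).app n) h1)
      · rintro ⟨y, hy1, hy2⟩
        have := Nonsingular.isIso_toOfSimplex x hx
        obtain ⟨s, hs⟩ := ((isIso_iff_bijective _).1
          (inferInstance : IsIso ((Subcomplex.toOfSimplex x).app n))).2 ⟨y, hy2⟩
        have hs' : (yonedaEquiv.symm x).app n s = y := congrArg Subtype.val hs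
        exact ⟨⟨s, (hmem s).2 (hs' ▸ hy1)⟩, Subtype.ext hs'⟩
    exact NatIso.isIso_of_isIso_app t₀
  have sq : Subcomplex.BicartSq (A ⊓ Subcomplex.ofSimplex x) A (Subcomplex.ofSimplex x)
      (A ⊔ Subcomplex.ofSimplex x) := ⟨rfl, rfl⟩
  let e := Nonsingular.iso x hx
  refine ⟨t₀ ≫ Subcomplex.homOfLE inf_le_left, e.hom ≫ Subcomplex.homOfLE le_sup_right,
    sq.isPushout.of_iso (asIso t₀).symm (Iso.refl _) e.symm (Iso.refl _) ?_ ?_ ?_ ?_⟩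
  · simp [t₀]
  · rw [← cancel_mono e.hom]
    simp only [Iso.symm_hom, asIso_inv, Category.assoc, Iso.inv_hom_id, Category.comp_id,
      IsIso.eq_inv_comp]
    rfl
  · simp
  · simp only [Iso.refl_hom, Category.comp_id, Iso.symm_hom, Iso.inv_hom_id_assoc]

/-- A class of maps that is closed under composition and cobase change and contains the boundary
inclusions contains the inclusions between subcomplexes of a finite nonsingular simplicial set:
the missing nondegenerate simplices are attached in order of dimension. -/
lemma homOfLE_mem_of_boundary_mem (W : MorphismProperty SSet.{u}) [W.IsMultiplicative]
    [W.IsStableUnderCobaseChange] (hW : ∀ d : ℕ, W ∂Δ[d].ι) {X : SSet.{u}} [X.Nonsingular]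
    [X.Finite] {A B : X.Subcomplex} (hAB : A ≤ B) : W (Subcomplex.homOfLE hAB) := by
  let c : X.Subcomplex → ℕ := fun A => ({s | s.simplex ∉ A.obj (op ⦋s.dim⦌)} : Set X.N).ncard
  induction h : c A using Nat.strong_induction_on generalizing A with
  | _ n ih =>
  by_cases hBA : B ≤ A
  · obtain rfl := le_antisymm hAB hBA
    exact W.id_mem _
  -- A simplex of minimal dimension that is in `B` but not in `A`.
  have hex : ∃ d, ∃ x ∈ X.nonDegenerate d, x ∈ B.obj (op ⦋d⦌) ∧ x ∉ A.obj (op ⦋d⦌) := by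
    by_contra! hcon
    exact hBA (Subcomplex.le_iff_contains_nonDegenerate _ _ |>.2
      fun d x hx => hcon d x.1 x.2 hx)
  classical
  obtain ⟨d, ⟨x, hx, hxB, hxA⟩, hmin⟩ : ∃ d, (∃ x ∈ X.nonDegenerate d,
      x ∈ B.obj (op ⦋d⦌) ∧ x ∉ A.obj (op ⦋d⦌)) ∧ ∀ k < d, ∀ y ∈ X.nonDegenerate k,
      y ∈ B.obj (op ⦋k⦌) → y ∈ A.obj (op ⦋k⦌) :=
    ⟨Nat.find hex, Nat.find_spec hex, fun k hk y hy hyB => by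
      by_contra hyA
      exact Nat.find_min hex hk ⟨y, hy, hyB, hyA⟩⟩
  have hpre : A.preimage (yonedaEquiv.symm x) = ∂Δ[d] := by
    have := Nonsingular.mono' x hx
    rw [stdSimplex.eq_boundary_iff]
    refine ⟨?_, fun h => hxA ?_⟩
    · rw [Subcomplex.le_iff_contains_nonDegenerate]
      intro k y hy
      have hk : k < d := dim_lt_of_nonDegenerate (X := ∂Δ[d])
        ⟨⟨y.1, hy⟩, (Subcomplex.mem_nonDegenerate_iff _ _).2 y.2⟩ d
      refine hmin k hk _ ((nonDegenerate_iff_of_mono (yonedaEquiv.symm x) _).2 y.2) ?_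
      have h1 : Subcomplex.ofSimplex x ≤ B := (Subcomplex.ofSimplex_le_iff _ _).2 hxB
      exact h1 _ ((Subcomplex.toOfSimplex x).app _ y.1).2
    · have := h.symm.le _ (show stdSimplex.objEquiv.symm (𝟙 ⦋d⦌) ∈ _ from Set.mem_univ _)
      simpa using this
  obtain ⟨t, b, hpo⟩ := isPushout_attachSimplex A x hx hpre
  have hle : A ⊔ Subcomplex.ofSimplex x ≤ B :=
    sup_le hAB ((Subcomplex.ofSimplex_le_iff _ _).2 hxB)
  have hW1 : W (Subcomplex.homOfLE (le_sup_left : A ≤ A ⊔ Subcomplex.ofSimplex x)) :=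
    W.of_isPushout hpo (hW d)
  have hlt : c (A ⊔ Subcomplex.ofSimplex x) < c A := by
    refine Set.ncard_lt_ncard ?_ (Set.toFinite _)
    refine ⟨fun s hs hsA => hs ((le_sup_left : A ≤ A ⊔ Subcomplex.ofSimplex x) _ hsA),
      fun hcon => ?_⟩
    have h2 : N.mk x hx ∈ ({s | s.simplex ∉ A.obj (op ⦋s.dim⦌)} : Set X.N) := hxA
    exact hcon h2 ((le_sup_right : _ ≤ A ⊔ Subcomplex.ofSimplex x) _
      (Subcomplex.mem_ofSimplex_obj x))
  have := W.comp_mem _ _ hW1 (ih _ (h ▸ hlt) hle rfl)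
  exact this

variable {X Y : SSet.{u}}

/-- The boundary of the face of a horn's missing index lies in the horn. -/
lemma exists_boundary_to_horn (k : ℕ) :
    ∃ φ : (∂Δ[k] : SSet.{u}) ⟶ (Λ[k + 1, 0] : SSet.{u}),
      φ ≫ Λ[k + 1, 0].ι = ∂Δ[k].ι ≫ stdSimplex.δ 0 := by
  refine ⟨Subcomplex.lift (∂Δ[k].ι ≫ stdSimplex.δ 0) ?_, rfl⟩
  refine (subcomplex_le_horn_iff _ _).2 fun h => ?_
  rw [stdSimplex.face_singleton_compl, Subcomplex.ofSimplex_le_iff] at h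
  obtain ⟨s, hs⟩ := h
  have hs' : (stdSimplex.δ 0).app _ s.1 =
      (stdSimplex.δ 0).app _ (stdSimplex.objEquiv.symm (𝟙 ⦋k⦌)) := hs.trans (by rfl)
  have h1 : s.1 = stdSimplex.objEquiv.symm (𝟙 ⦋k⦌) :=
    injective_of_mono ((stdSimplex.{u}.δ (0 : Fin (k + 2))).app (op ⦋k⦌)) hs'
  have h2 : s.1 ∈ ∂Δ[k].obj (op ⦋k⦌) := s.2
  rw [h1] at h2
  exact stdSimplex.notMem_boundary k h2

/-- If `(k + 1)`-dimensional horns have unique fillers in `X` and at most one in `Y`, and if a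
`k`-simplex of `X` is determined by its boundary and its image in `Y`, then
relative `(k + 1)`-spheres have unique fillers: fill a horn, and compare the remaining face. -/
lemma existsUnique_boundary_filler (f : X ⟶ Y) (k : ℕ)
    (hX : ∀ b : (Λ[k + 1, 0] : SSet.{u}) ⟶ X, ∃! z : Δ[k + 1] ⟶ X, Λ[k + 1, 0].ι ≫ z = b)
    (hY : ∀ z z' : Δ[k + 1] ⟶ Y, Λ[k + 1, 0].ι ≫ z = Λ[k + 1, 0].ι ≫ z' → z = z')
    (hk : ∀ z z' : Δ[k] ⟶ X, ∂Δ[k].ι ≫ z = ∂Δ[k].ι ≫ z' → z ≫ f = z' ≫ f → z = z')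
    (b : (∂Δ[k + 1] : SSet.{u}) ⟶ X) (c : Δ[k + 1] ⟶ Y) (h : b ≫ f = ∂Δ[k + 1].ι ≫ c) :
    ∃! z : Δ[k + 1] ⟶ X, ∂Δ[k + 1].ι ≫ z = b ∧ z ≫ f = c := by
  have hle : Λ[k + 1, 0] ≤ (∂Δ[k + 1] : Δ[k + 1].Subcomplex) := by
    rw [stdSimplex.le_boundary_iff]
    intro h
    have h1 := (subcomplex_le_horn_iff (Λ[k + 1, 0] : Δ[k + 1].Subcomplex) 0).1 le_rfl
    exact h1 (h ▸ le_top)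
  have hι : Subcomplex.homOfLE hle ≫ ∂Δ[k + 1].ι = Λ[k + 1, 0].ι := rfl
  obtain ⟨z, hz, -⟩ := hX (Subcomplex.homOfLE hle ≫ b)
  have hzc : z ≫ f = c := hY _ _ (by
    rw [← Category.assoc, hz, Category.assoc, h, ← Category.assoc, hι])
  have hzb : ∂Δ[k + 1].ι ≫ z = b := by
    refine boundary.hom_ext fun i => ?_
    rw [boundary.ι_ι_assoc]
    by_cases hi : i = 0
    · subst hi
      refine hk _ _ ?_ ?_
      · obtain ⟨φ, hφ⟩ := exists_boundary_to_horn.{u} k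
        have h1 : φ ≫ Subcomplex.homOfLE hle = ∂Δ[k].ι ≫ boundary.ι 0 := by
          rw [← cancel_mono ∂Δ[k + 1].ι, Category.assoc, hι, hφ, Category.assoc, boundary.ι_ι]
        rw [← Category.assoc, ← hφ, Category.assoc, hz, ← Category.assoc, h1, Category.assoc]
      · rw [Category.assoc, Category.assoc, hzc, h, boundary.ι_ι_assoc]
    · have h1 : horn.ι 0 i hi ≫ Subcomplex.homOfLE hle = boundary.ι i := by
        rw [← cancel_mono ∂Δ[k + 1].ι, Category.assoc, hι, boundary.ι_ι, horn.ι_ι]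
      rw [← horn.ι_ι 0 i hi, Category.assoc, hz, ← Category.assoc, h1]
  refine ⟨z, ⟨hzb, hzc⟩, fun z' hz' => ?_⟩
  refine (hX (Subcomplex.homOfLE hle ≫ b)).unique ?_ hz
  rw [← hι, Category.assoc, hz'.1]

end SSet

/-! ### Covers of presheaves on the category of manifolds -/

/-- Squares of presheaves are cartesian if they are so on elements. -/
lemma isPullback_of_forall_existsUnique {C : Type*} [Category C] {F₁ F₂ F₃ F₄ : Cᵒᵖ ⥤ Type u}
    {t : F₁ ⟶ F₂} {l : F₁ ⟶ F₃} {r : F₂ ⟶ F₄} {b : F₃ ⟶ F₄} (w : t ≫ r = l ≫ b)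
    (h : ∀ (T : Cᵒᵖ) (x : F₂.obj T) (y : F₃.obj T), r.app T x = b.app T y →
      ∃! z : F₁.obj T, t.app T z = x ∧ l.app T z = y) : IsPullback t l r b where
  w := w
  isLimit' := ⟨Limits.evaluationJointlyReflectsLimits _ fun T => by
    refine (Limits.isLimitMapConePullbackConeEquiv _ _).2 (IsPullback.isLimit ?_)
    have w' : t.app T ≫ r.app T = l.app T ≫ b.app T := NatTrans.congr_app w T
    refine (Limits.Types.isPullback_iff _ _ _ _).2 ⟨w', fun z z' hz => ?_, fun x y hxy =>
      (h T x y hxy).exists⟩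
    exact (h T (t.app T z') (l.app T z') (ConcreteCategory.congr_hom w' z')).unique hz ⟨rfl, rfl⟩⟩

/-- The class of surjective submersions. -/
def surjectiveSubmersions : MorphismProperty BanachManifold.{u} :=
  fun _ _ f => IsSurjectiveSubmersion f

instance : surjectiveSubmersions.{u}.IsMultiplicative where
  id_mem X := IsSurjectiveSubmersion.of_isIso (𝟙 X)
  comp_mem _ _ hf hg := IsSurjectiveSubmersion.comp hf hg

instance : surjectiveSubmersions.{u}.RespectsIso :=
  MorphismProperty.respectsIso_of_isStableUnderComposition fun _ _ f hf =>
    have : IsIso f := hf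
    IsSurjectiveSubmersion.of_isIso f

/-- The class of maps of presheaves on manifolds whose pullbacks to manifolds are (represented by)
surjective submersions of manifolds. -/
abbrev presheafCovers : MorphismProperty (BanachManifold.{u}ᵒᵖ ⥤ Type u) :=
  surjectiveSubmersions.presheaf

instance : presheafCovers.{u}.IsStableUnderBaseChange :=
  MorphismProperty.relative_isStableUnderBaseChange _

lemma presheafCovers_of_isIso {F G : BanachManifold.{u}ᵒᵖ ⥤ Type u} (f : F ⟶ G) [IsIso f] :
    presheafCovers f :=
  MorphismProperty.of_isIso _ f

/-- Surjective submersions can be pulled back, so they are covers of presheaves. -/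
lemma presheafCovers_yoneda_map {M N : BanachManifold.{u}} {p : M ⟶ N}
    (hp : surjectiveSubmersions p) : presheafCovers (yoneda.map p) := by
  refine MorphismProperty.relative.of_exists fun Q g => ?_
  obtain ⟨g, rfl⟩ := yoneda.map_surjective g
  exact ⟨fibreProduct hp g, yoneda.map (fibreProductFst g hp : fibreProduct hp g ⟶ M),
    (fibreProductSnd g hp : fibreProduct hp g ⟶ Q),
    (isPullback_fibreProduct (p := p) g hp).map yoneda, isSurjectiveSubmersion_fibreProductSnd g hp⟩

lemma isRepresentable_of_presheafCovers {F G : BanachManifold.{u}ᵒᵖ ⥤ Type u} {f : F ⟶ G}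
    (hf : presheafCovers f) (hG : G.IsRepresentable) : F.IsRepresentable := by
  have h := hf.rep.isPullback G.reprW.hom
  have : IsIso (hf.rep.fst G.reprW.hom) := h.isIso_fst_of_isIso
  exact Functor.IsRepresentable.mk' (asIso (hf.rep.fst G.reprW.hom))

section Points

variable {X : BanachManifold.{u}} {F : BanachManifold.{u}ᵒᵖ ⥤ Type u} (p : F.obj (op X))

/-- The map of presheaves that corresponds to `p`, when `F` is represented by `H`. -/
lemma yonedaEquiv_symm_eq {H : BanachManifold.{u}} (r : F.RepresentableBy H) :
    yonedaEquiv.symm p = yoneda.map (r.homEquiv.symm p) ≫ r.toIso.hom := by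
  apply yonedaEquiv.injective
  rw [Equiv.apply_symm_apply, ← yonedaEquiv_naturality, yonedaEquiv_apply]
  refine Eq.trans ?_ (r.homEquiv_comp (r.homEquiv.symm p) (𝟙 H))
  rw [Category.comp_id, Equiv.apply_symm_apply]

lemma isCoverOfSpace_iff :
    IsCoverOfSpace p ↔ F.IsRepresentable ∧ presheafCovers (yonedaEquiv.symm p) := by
  constructor
  · rintro ⟨H, r, h⟩
    refine ⟨r.isRepresentable, ?_⟩
    rw [yonedaEquiv_symm_eq p r]
    exact MorphismProperty.comp_mem _ _ _ (presheafCovers_yoneda_map h)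
      (presheafCovers_of_isIso _)
  · rintro ⟨hF, h⟩
    refine ⟨F.reprX, F.representableBy, ?_⟩
    have h1 : presheafCovers (yoneda.map (F.representableBy.homEquiv.symm p)) := by
      have h2 := MorphismProperty.comp_mem _ _ _ h
        (presheafCovers_of_isIso F.representableBy.toIso.inv)
      rwa [yonedaEquiv_symm_eq p F.representableBy, Category.assoc, Iso.hom_inv_id,
        Category.comp_id] at h2
    exact MorphismProperty.of_relative_map h1

lemma isDiffeoOntoSpace_iff : IsDiffeoOntoSpace p ↔ IsIso (yonedaEquiv.symm p) := by
  constructor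
  · rintro ⟨H, r, h⟩
    rw [yonedaEquiv_symm_eq p r]
    infer_instance
  · intro h
    let r : F.RepresentableBy X := Functor.representableByEquiv.symm (asIso (yonedaEquiv.symm p))
    refine ⟨X, r, ?_⟩
    have h1 : IsIso (yoneda.map (r.homEquiv.symm p)) := by
      have h2 := yonedaEquiv_symm_eq p r
      rw [← Iso.comp_inv_eq] at h2
      rw [← h2]
      infer_instance
    exact isIso_of_fully_faithful yoneda _

lemma isCoverOfSpace_app_iff (hp : IsIso (yonedaEquiv.symm p))
    {G : BanachManifold.{u}ᵒᵖ ⥤ Type u} (α : F ⟶ G) :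
    IsCoverOfSpace (α.app (op X) p) ↔ G.IsRepresentable ∧ presheafCovers α := by
  rw [isCoverOfSpace_iff, ← yonedaEquiv_symm_naturality_right,
    MorphismProperty.cancel_left_of_respectsIso presheafCovers]

lemma isDiffeoOntoSpace_app_iff (hp : IsIso (yonedaEquiv.symm p))
    {G : BanachManifold.{u}ᵒᵖ ⥤ Type u} (α : F ⟶ G) :
    IsDiffeoOntoSpace (α.app (op X) p) ↔ IsIso α := by
  rw [isDiffeoOntoSpace_iff, ← yonedaEquiv_symm_naturality_right, isIso_comp_left_iff]

end Points

/-! ### Spaces of maps into simplicial manifolds -/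

section HomSpace

variable {X Y Z : SimplicialManifold.{u}} {A B C : SSet.{u}}

/-- Restriction along `i : A → B`, as a map `Hom(B, X) → Hom(A, X)`. -/
def homSpaceRestrict (i : A ⟶ B) (X : SimplicialManifold.{u}) : homSpace B X ⟶ homSpace A X :=
  Functor.whiskerLeft (simplicialPoints X) (coyoneda.map i.op)

/-- Composition with `f : X → Y`, as a map `Hom(A, X) → Hom(A, Y)`. -/
def homSpaceMap (A : SSet.{u}) (f : X ⟶ Y) : homSpace A X ⟶ homSpace A Y :=
  Functor.whiskerRight (simplicialPointsMap f) (coyoneda.obj (op A))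

/-- The fibre product `Hom(A, X) ×_{Hom(A, Y)} Hom(B, Y)` for `i : A → B` and `f : X → Y`. If `i` is
the inclusion of `∂Δ[k]` into `Δ[k]`, this is the relative matching space of `f` by definition. -/
def gapSpace (i : A ⟶ B) (f : X ⟶ Y) : BanachManifold.{u}ᵒᵖ ⥤ Type u where
  obj T := { p : (A ⟶ (simplicialPoints X).obj T) × (B ⟶ (simplicialPoints Y).obj T) //
      p.1 ≫ (simplicialPointsMap f).app T = i ≫ p.2 }
  map g := ↾fun p => ⟨(p.1.1 ≫ (simplicialPoints X).map g, p.1.2 ≫ (simplicialPoints Y).map g), by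
    have h := p.2
    rw [Category.assoc, (simplicialPointsMap f).naturality g, ← Category.assoc, h,
      Category.assoc]⟩
  map_id T := by
    ext p
    all_goals simp
  map_comp g h := by
    ext p
    all_goals simp

/-- The projection of the fibre product to `Hom(A, X)`. -/
def gapFst (i : A ⟶ B) (f : X ⟶ Y) : gapSpace i f ⟶ homSpace A X where
  app T := ↾fun p => p.1.1

/-- The projection of the fibre product to `Hom(B, Y)`. -/
def gapSnd (i : A ⟶ B) (f : X ⟶ Y) : gapSpace i f ⟶ homSpace B Y where
  app T := ↾fun p => p.1.2

/-- The gap map of `f` at `i : A → B`: the canonical map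
`Hom(B, X) → Hom(A, X) ×_{Hom(A, Y)} Hom(B, Y)`. -/
def gapMap (i : A ⟶ B) (f : X ⟶ Y) : homSpace B X ⟶ gapSpace i f where
  app T := ↾fun b => ⟨(i ≫ b, b ≫ (simplicialPointsMap f).app T), Category.assoc _ _ _⟩
  naturality S T g := by
    ext b
    refine Subtype.ext (Prod.ext (Category.assoc _ _ _).symm ?_)
    exact (Category.assoc _ _ _).trans ((congrArg (b ≫ ·)
      ((simplicialPointsMap f).naturality g)).trans (Category.assoc _ _ _).symm)

lemma isPullback_gapSpace (i : A ⟶ B) (f : X ⟶ Y) :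
    IsPullback (gapFst i f) (gapSnd i f) (homSpaceMap A f) (homSpaceRestrict i Y) :=
  isPullback_of_forall_existsUnique (by ext T p; exact p.2) fun T x y h =>
    ⟨⟨(x, y), h⟩, ⟨rfl, rfl⟩, fun z hz => Subtype.ext (Prod.ext hz.1 hz.2)⟩

end HomSpace

/-! ### Gap maps under composition and base change -/

section GapSquares

variable {X Y Z X' Y' : SimplicialManifold.{u}} {A B C A' B' : SSet.{u}}

/-- The map of fibre products induced by a commutative square of simplicial sets. -/
def gapSpaceRestrict {i : A ⟶ B} {i' : A' ⟶ B'} (u : A' ⟶ A) (v : B' ⟶ B) (h : u ≫ i = i' ≫ v)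
    (f : X ⟶ Y) : gapSpace i f ⟶ gapSpace i' f where
  app T := ↾fun p => ⟨(u ≫ p.1.1, v ≫ p.1.2), by
    rw [Category.assoc, p.2, ← Category.assoc, h, Category.assoc]⟩
  naturality S T g := by
    ext p
    exact Subtype.ext (Prod.ext (Category.assoc _ _ _).symm (Category.assoc _ _ _).symm)

/-- The map of fibre products induced by a commutative square of simplicial manifolds. -/
def gapSpaceMap (i : A ⟶ B) {f : X ⟶ Y} {f' : X' ⟶ Y'} (p : X ⟶ X') (q : Y ⟶ Y')
    (h : p ≫ f' = f ≫ q) : gapSpace i f ⟶ gapSpace i f' where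
  app T := ↾fun z => ⟨(z.1.1 ≫ (simplicialPointsMap p).app T,
      z.1.2 ≫ (simplicialPointsMap q).app T), by
    have h1 : (simplicialPointsMap p).app T ≫ (simplicialPointsMap f').app T =
        (simplicialPointsMap f).app T ≫ (simplicialPointsMap q).app T :=
      congrArg (fun k : X ⟶ Y' => (simplicialPointsMap k).app T) h
    rw [Category.assoc, h1, ← Category.assoc, z.2, Category.assoc]⟩
  naturality S T g := by
    ext z
    refine Subtype.ext (Prod.ext ?_ ?_)
    · exact (Category.assoc _ _ _).trans ((congrArg (z.1.1 ≫ ·)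
        ((simplicialPointsMap p).naturality g)).trans (Category.assoc _ _ _).symm)
    · exact (Category.assoc _ _ _).trans ((congrArg (z.1.2 ≫ ·)
        ((simplicialPointsMap q).naturality g)).trans (Category.assoc _ _ _).symm)

lemma gapMap_comp_gapFst (i : A ⟶ B) (f : X ⟶ Y) :
    gapMap i f ≫ gapFst i f = homSpaceRestrict i X := rfl

lemma gapMap_comp_gapSnd (i : A ⟶ B) (f : X ⟶ Y) :
    gapMap i f ≫ gapSnd i f = homSpaceMap B f := rfl

/-- The gap map at `i ≫ j` is that at `j` followed by a base change of that at `i`. -/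
lemma gapMap_comp_left (i : A ⟶ B) (j : B ⟶ C) (f : X ⟶ Y) :
    gapMap (i ≫ j) f = gapMap j f ≫ gapSpaceRestrict i (𝟙 C) (by simp) f := by
  ext T b
  exact Subtype.ext (Prod.ext (Category.assoc _ _ _) (Category.id_comp _).symm)

/-- The second factor in `gapMap_comp_left` is a base change of the gap map at `i`. -/
lemma isPullback_gapMap_comp_left (i : A ⟶ B) (j : B ⟶ C) (f : X ⟶ Y) :
    IsPullback (gapFst j f) (gapSpaceRestrict (i' := i ≫ j) i (𝟙 C) (by simp) f)
      (gapMap i f) (gapSpaceRestrict (𝟙 A) j (by simp) f) := by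
  refine isPullback_of_forall_existsUnique ?_ fun T b y h => ?_
  · ext T p
    refine Subtype.ext (Prod.ext (Category.id_comp _).symm ?_)
    exact p.2.trans (congrArg (j ≫ ·) (Category.id_comp _).symm)
  · have h1 : i ≫ b = 𝟙 A ≫ y.1.1 := congrArg (fun p => p.1.1) h
    have h2 : b ≫ (simplicialPointsMap f).app T = j ≫ y.1.2 := congrArg (fun p => p.1.2) h
    refine ⟨⟨(b, y.1.2), h2⟩, ⟨rfl, Subtype.ext (Prod.ext (h1.trans (Category.id_comp _))
      (Category.id_comp _))⟩, fun z hz => Subtype.ext (Prod.ext hz.1 ?_)⟩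
    exact (Category.id_comp _).symm.trans (congrArg (fun p => p.1.2) hz.2)

/-- A cobase change of simplicial sets induces a base change of gap maps. -/
lemma isPullback_gapMap_of_isPushout {u : A' ⟶ A} {i' : A' ⟶ B'} {i : A ⟶ B} {v : B' ⟶ B}
    (sq : IsPushout u i' i v) (f : X ⟶ Y) :
    IsPullback (homSpaceRestrict v X) (gapMap i f) (gapMap i' f)
      (gapSpaceRestrict u v sq.w f) := by
  refine isPullback_of_forall_existsUnique ?_ ?_
  · ext T b
    refine Subtype.ext (Prod.ext ?_ (Category.assoc _ _ _))
    exact (Category.assoc _ _ _).symm.trans ((congrArg (· ≫ b) sq.w.symm).trans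
      (Category.assoc _ _ _))
  · rintro T (b : B' ⟶ (simplicialPoints X).obj T) ⟨⟨a, c⟩, (hy : a ≫ _ = i ≫ c)⟩ h
    have h1 : i' ≫ b = u ≫ a := congrArg (fun p => p.1.1) h
    have h2 : b ≫ (simplicialPointsMap f).app T = v ≫ c := congrArg (fun p => p.1.2) h
    have h3 : sq.desc a b h1.symm ≫ (simplicialPointsMap f).app T = c := by
      refine sq.hom_ext ?_ ?_
      · rw [IsPushout.inl_desc_assoc, hy]
      · rw [IsPushout.inr_desc_assoc, h2]
    refine ⟨sq.desc a b h1.symm, ⟨sq.inr_desc _ _ _,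
      Subtype.ext (Prod.ext (sq.inl_desc _ _ _) h3)⟩,
      fun (z : B ⟶ (simplicialPoints X).obj T) hz => sq.hom_ext ?_ ?_⟩
    · rw [sq.inl_desc]
      exact congrArg (fun p => p.1.1) hz.2
    · rw [sq.inr_desc]
      exact hz.1

/-- The gap map of `f ≫ g` is that of `f` followed by a base change of that of `g`. -/
lemma gapMap_comp_right (i : A ⟶ B) (f : X ⟶ Y) (g : Y ⟶ Z) :
    gapMap i (f ≫ g) = gapMap i f ≫ gapSpaceMap i (𝟙 X) g (by simp) := by
  ext T b
  exact Subtype.ext (Prod.ext (Category.comp_id _).symm (Category.assoc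
    (obj := SSet.{u}) (show B ⟶ (simplicialPoints X).obj T from b) ((simplicialPointsMap f).app T)
    ((simplicialPointsMap g).app T)).symm)

/-- The second factor in `gapMap_comp_right` is a base change of the gap map of `g`. -/
lemma isPullback_gapMap_comp_right (i : A ⟶ B) (f : X ⟶ Y) (g : Y ⟶ Z) :
    IsPullback (gapSnd i f) (gapSpaceMap (f' := f ≫ g) i (𝟙 X) g (by simp)) (gapMap i g)
      (gapSpaceMap i f (𝟙 Z) (by simp)) := by
  refine isPullback_of_forall_existsUnique ?_ fun T b y h => ?_
  · ext T p
    refine Subtype.ext (Prod.ext ?_ (Category.comp_id _).symm)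
    exact p.2.symm.trans (congrArg (· ≫ (simplicialPointsMap f).app T) (Category.comp_id _).symm)
  · have h1 : i ≫ b = y.1.1 ≫ (simplicialPointsMap f).app T := congrArg (fun p => p.1.1) h
    have h2 : b ≫ (simplicialPointsMap g).app T = y.1.2 ≫ 𝟙 _ := congrArg (fun p => p.1.2) h
    refine ⟨⟨(y.1.1, b), h1.symm⟩, ⟨rfl, Subtype.ext (Prod.ext (Category.comp_id _)
      (h2.trans (Category.comp_id _)))⟩, fun z hz => Subtype.ext (Prod.ext ?_ hz.1)⟩
    exact (Category.comp_id _).symm.trans (congrArg (fun p => p.1.1) hz.2)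

/-- The target of the gap map of `f ≫ g` is a base change of `Hom(A, X) → Hom(A, Y)`. -/
lemma isPullback_gapSpaceMap_comp (i : A ⟶ B) (f : X ⟶ Y) (g : Y ⟶ Z) :
    IsPullback (gapFst i (f ≫ g)) (gapSpaceMap (f' := g) i f (𝟙 Z) (by simp))
      (homSpaceMap A f) (gapFst i g) := by
  refine isPullback_of_forall_existsUnique rfl ?_
  rintro T (a : A ⟶ (simplicialPoints X).obj T) ⟨⟨a', c⟩, (hy : a' ≫ _ = i ≫ c)⟩
    (h : a ≫ (simplicialPointsMap f).app T = a')
  have h2 : a ≫ (simplicialPointsMap f).app T ≫ (simplicialPointsMap g).app T = i ≫ c := by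
    rw [← hy, ← h, Category.assoc]
  refine ⟨⟨(a, c), h2⟩, ⟨rfl, Subtype.ext (Prod.ext h (Category.comp_id _))⟩,
    fun z hz => Subtype.ext (Prod.ext hz.1 ?_)⟩
  exact (Category.comp_id _).symm.trans (congrArg (fun p => p.1.2) hz.2)

section BaseChange

/-! In the following lemmas `X' = X ×_Y Y'`, levelwise. -/

variable {f : X ⟶ Y} {f' : X' ⟶ Y'} {p : X' ⟶ X} {q : Y' ⟶ Y}
  (sq : ∀ k : ℕ, IsPullback (p.app (op (.mk k))) (f'.app (op (.mk k)))
    (f.app (op (.mk k))) (q.app (op (.mk k))))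

include sq

lemma comp_eq_of_levelwise : p ≫ f = f' ≫ q := by
  ext k : 2
  obtain ⟨⟨k⟩⟩ := k
  exact (sq k).w

lemma isPullback_simplicialPoints (T : BanachManifold.{u}ᵒᵖ) :
    IsPullback ((simplicialPointsMap p).app T) ((simplicialPointsMap f').app T)
      ((simplicialPointsMap f).app T) ((simplicialPointsMap q).app T) := by
  refine isPullback_of_forall_existsUnique
    (congrArg (fun k : X' ⟶ Y => (simplicialPointsMap k).app T) (comp_eq_of_levelwise sq)) ?_
  rintro ⟨⟨k⟩⟩ (x : T.unop ⟶ X.level k) (y : T.unop ⟶ Y'.level k) h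
  have h' : x ≫ f.app (op (.mk k)) = y ≫ q.app (op (.mk k)) := h
  exact ⟨(sq k).lift x y h', ⟨(sq k).lift_fst x y h', (sq k).lift_snd x y h'⟩,
    fun z hz => (sq k).hom_ext (hz.1.trans ((sq k).lift_fst x y h').symm)
      (hz.2.trans ((sq k).lift_snd x y h').symm)⟩

lemma isPullback_homSpaceMap (A : SSet.{u}) :
    IsPullback (homSpaceMap A p) (homSpaceMap A f') (homSpaceMap A f) (homSpaceMap A q) := by
  refine isPullback_of_forall_existsUnique ?_ fun T a b h => ?_
  · exact congrArg (fun k : X' ⟶ Y => homSpaceMap A k) (comp_eq_of_levelwise sq)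
  · have hT := isPullback_simplicialPoints sq T
    exact ⟨hT.lift a b h, ⟨hT.lift_fst a b h, hT.lift_snd a b h⟩,
      fun z hz => hT.hom_ext (hz.1.trans (hT.lift_fst a b h).symm)
        (hz.2.trans (hT.lift_snd a b h).symm)⟩

/-- A base change of simplicial manifolds induces a base change of gap maps. -/
lemma isPullback_gapMap_of_levelwise (i : A ⟶ B) :
    IsPullback (homSpaceMap B p) (gapMap i f') (gapMap i f)
      (gapSpaceMap i p q (comp_eq_of_levelwise sq)) := by
  refine isPullback_of_forall_existsUnique ?_ ?_
  · ext T b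
    refine Subtype.ext (Prod.ext (Category.assoc _ _ _).symm ?_)
    have h1 := (isPullback_simplicialPoints sq T).w
    exact (Category.assoc _ _ _).trans ((congrArg (b ≫ ·) h1).trans (Category.assoc _ _ _).symm)
  · rintro T (b : B ⟶ (simplicialPoints X).obj T) ⟨⟨a, c⟩, (hy : a ≫ _ = i ≫ c)⟩ h
    have hT := isPullback_simplicialPoints sq T
    have h1 : i ≫ b = a ≫ (simplicialPointsMap p).app T := congrArg (fun p => p.1.1) h
    have h2 : b ≫ (simplicialPointsMap f).app T = c ≫ (simplicialPointsMap q).app T :=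
      congrArg (fun p => p.1.2) h
    have h3 : i ≫ hT.lift b c h2 = a := by
      refine hT.hom_ext ?_ ?_
      · rw [Category.assoc, hT.lift_fst, h1]
      · rw [Category.assoc, hT.lift_snd, hy]
    refine ⟨hT.lift b c h2, ⟨hT.lift_fst _ _ _, Subtype.ext (Prod.ext h3
      (hT.lift_snd _ _ _))⟩, fun z hz => hT.hom_ext (hz.1.trans (hT.lift_fst _ _ _).symm) ?_⟩
    exact (congrArg (fun p => p.1.2) hz.2 : z ≫ (simplicialPointsMap f').app T = c).trans
      (hT.lift_snd _ _ _).symm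

/-- The target of the gap map of `f'` is a base change of `Hom(B, Y') → Hom(B, Y)`. -/
lemma isPullback_gapSpaceMap_of_levelwise (i : A ⟶ B) :
    IsPullback (gapSnd i f') (gapSpaceMap i p q (comp_eq_of_levelwise sq))
      (homSpaceMap B q) (gapSnd i f) := by
  refine isPullback_of_forall_existsUnique rfl ?_
  rintro T (b : B ⟶ (simplicialPoints Y').obj T) ⟨⟨a, c⟩, (hy : a ≫ _ = i ≫ c)⟩
    (h : b ≫ (simplicialPointsMap q).app T = c)
  have hT := isPullback_simplicialPoints sq T
  have h2 : a ≫ (simplicialPointsMap f).app T = (i ≫ b) ≫ (simplicialPointsMap q).app T := by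
    rw [hy, Category.assoc, h]
  refine ⟨⟨(hT.lift a (i ≫ b) h2, b), hT.lift_snd _ _ _⟩, ⟨rfl, Subtype.ext (Prod.ext
    (hT.lift_fst _ _ _) h)⟩, ?_⟩
  rintro ⟨⟨a', b'⟩, hz⟩ ⟨(rfl : b' = b), hz2⟩
  refine Subtype.ext (Prod.ext (hT.hom_ext ?_ ?_) rfl)
  · exact (congrArg (fun p => p.1.1) hz2 : a' ≫ (simplicialPointsMap p).app T = a).trans
      (hT.lift_fst _ _ _).symm
  · exact hz.trans (hT.lift_snd _ _ _).symm

end BaseChange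

end GapSquares

/-! ### Hypercovers in terms of presheaves -/

section Simplices

variable {X Y : SimplicialManifold.{u}}

/-- The tautological map from the manifold `X_k` to the space of maps `Δ[k] → X`. -/
def simplexSpaceMap (X : SimplicialManifold.{u}) (k : ℕ) :
    yoneda.obj (X.level k) ⟶ homSpace (SSet.stdSimplex.obj (.mk k)) X :=
  yonedaEquiv.symm (universalSimplex X k)

instance isIso_simplexSpaceMap (X : SimplicialManifold.{u}) (k : ℕ) :
    IsIso (simplexSpaceMap X k) := by
  refine (NatTrans.isIso_iff_isIso_app _).2 fun T => (isIso_iff_bijective _).2 ?_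
  have key (g : T.unop ⟶ X.level k) :
      universalSimplex X k ≫ (simplicialPoints X).map g.op = SSet.yonedaEquiv.symm g :=
    (SSet.yonedaEquiv_symm_comp _ ((simplicialPoints X).map g.op)).trans
      (congrArg SSet.yonedaEquiv.symm (Category.comp_id g))
  refine ⟨fun g g' h => SSet.yonedaEquiv.symm.injective ((key g).symm.trans (h.trans (key g'))),
    fun z => ⟨SSet.yonedaEquiv z, (key _).trans (SSet.yonedaEquiv.symm_apply_apply z)⟩⟩

lemma isLieGroupoid_iff {n : ℕ} : IsLieGroupoid n X ↔
    (∀ (l : ℕ) (j : Fin (l + 1)), 1 ≤ l → (homSpace (SSet.horn.{u} l j) X).IsRepresentable ∧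
      presheafCovers (homSpaceRestrict (SSet.horn.{u} l j).ι X)) ∧
    ∀ (l : ℕ) (j : Fin (l + 1)), n < l → IsIso (homSpaceRestrict (SSet.horn.{u} l j).ι X) :=
  ⟨fun h => ⟨fun l j hl => (isCoverOfSpace_app_iff _ (isIso_simplexSpaceMap X l)
      (homSpaceRestrict (SSet.horn.{u} l j).ι X)).1 (h.kan l j hl),
    fun l j hl => (isDiffeoOntoSpace_app_iff _ (isIso_simplexSpaceMap X l)
      (homSpaceRestrict (SSet.horn.{u} l j).ι X)).1 (h.strict_kan l j hl)⟩,
  fun h => ⟨fun l j hl => (isCoverOfSpace_app_iff _ (isIso_simplexSpaceMap X l)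
      (homSpaceRestrict (SSet.horn.{u} l j).ι X)).2 (h.1 l j hl),
    fun l j hl => (isDiffeoOntoSpace_app_iff _ (isIso_simplexSpaceMap X l)
      (homSpaceRestrict (SSet.horn.{u} l j).ι X)).2 (h.2 l j hl)⟩⟩

lemma isHypercover_iff {n : ℕ} {f : X ⟶ Y} : IsHypercover n f ↔
    (∀ i, i < n → (gapSpace (SSet.boundary.{u} i).ι f).IsRepresentable ∧
      presheafCovers (gapMap (SSet.boundary.{u} i).ι f)) ∧
    IsIso (gapMap (SSet.boundary.{u} n).ι f) :=
  ⟨fun h => ⟨fun i hi => (isCoverOfSpace_app_iff _ (isIso_simplexSpaceMap X _)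
      (gapMap (SSet.boundary.{u} i).ι f)).1 (h.cover i hi),
    (isDiffeoOntoSpace_app_iff _ (isIso_simplexSpaceMap X _)
      (gapMap (SSet.boundary.{u} n).ι f)).1 h.diffeo⟩,
  fun h => ⟨fun i hi => (isCoverOfSpace_app_iff _ (isIso_simplexSpaceMap X _)
      (gapMap (SSet.boundary.{u} i).ι f)).2 (h.1 i hi),
    (isDiffeoOntoSpace_app_iff _ (isIso_simplexSpaceMap X _)
      (gapMap (SSet.boundary.{u} n).ι f)).2 h.2⟩⟩

lemma surjectiveSubmersions_app_of_homSpaceMap {f : X ⟶ Y} {k : ℕ}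
    (hf : presheafCovers (homSpaceMap (SSet.stdSimplex.obj (.mk k)) f)) :
    surjectiveSubmersions (f.app (op (.mk k))) := by
  have h : yoneda.map (f.app (op (.mk k)) : X.level k ⟶ Y.level k) ≫
      simplexSpaceMap Y k =
      simplexSpaceMap X k ≫
        homSpaceMap (SSet.stdSimplex.obj (.mk k)) f := by
    refine (yonedaEquiv_symm_naturality_left _ _ _).trans (Eq.trans (congrArg yonedaEquiv.symm ?_)
      (yonedaEquiv_symm_naturality_right _ _ _).symm)
    refine (SSet.yonedaEquiv_symm_comp _ ((simplicialPoints Y).map (f.app _).op)).trans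
      (Eq.trans ?_ (SSet.yonedaEquiv_symm_comp _ ((simplicialPointsMap f).app _)).symm)
    exact congrArg SSet.yonedaEquiv.symm ((Category.comp_id (f.app (op (.mk k)))).trans
      (Category.id_comp (f.app (op (.mk k)))).symm)
  refine MorphismProperty.of_relative_map (F := yoneda) ?_
  refine (MorphismProperty.cancel_right_of_respectsIso presheafCovers _
    (simplexSpaceMap Y k)).1 ?_
  rw [h]
  exact (MorphismProperty.cancel_left_of_respectsIso presheafCovers _ _).2 hf

end Simplices

/-! ### Hypercovers have covering relative matching maps in all degrees -/

section Hypercover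

variable {X Y : SimplicialManifold.{u}} {A B : SSet.{u}}

lemma isIso_gapMap_iff {i : A ⟶ B} {f : X ⟶ Y} : IsIso (gapMap i f) ↔
    ∀ (T : BanachManifold.{u}ᵒᵖ) (a : A ⟶ (simplicialPoints X).obj T)
      (c : B ⟶ (simplicialPoints Y).obj T), a ≫ (simplicialPointsMap f).app T = i ≫ c →
        ∃! z : B ⟶ (simplicialPoints X).obj T,
          i ≫ z = a ∧ z ≫ (simplicialPointsMap f).app T = c := by
  rw [NatTrans.isIso_iff_isIso_app]
  refine forall_congr' fun T => ?_
  rw [isIso_iff_bijective, Function.bijective_iff_existsUnique]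
  constructor
  · intro H a c h
    obtain ⟨z, hz, hz'⟩ := H ⟨(a, c), h⟩
    exact ⟨z, ⟨congrArg (fun p => p.1.1) hz, congrArg (fun p => p.1.2) hz⟩,
      fun z' h' => hz' z' (Subtype.ext (Prod.ext h'.1 h'.2))⟩
  · rintro H ⟨⟨a, c⟩, h⟩
    obtain ⟨z, hz, hz'⟩ := H a c h
    exact ⟨z, Subtype.ext (Prod.ext hz.1 hz.2),
      fun z' h' => hz' z' ⟨congrArg (fun p => p.1.1) h', congrArg (fun p => p.1.2) h'⟩⟩

lemma isIso_homSpaceRestrict_iff {i : A ⟶ B} : IsIso (homSpaceRestrict i X) ↔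
    ∀ (T : BanachManifold.{u}ᵒᵖ) (a : A ⟶ (simplicialPoints X).obj T),
      ∃! z : B ⟶ (simplicialPoints X).obj T, i ≫ z = a := by
  rw [NatTrans.isIso_iff_isIso_app]
  refine forall_congr' fun T => ?_
  rw [isIso_iff_bijective, Function.bijective_iff_existsUnique]
  rfl

/-- In degrees `k ≥ n` the relative matching maps of a hypercover of Lie `n`-groupoids are
isomorphisms, because horns of dimension above `n` have unique fillers. -/
lemma IsHypercover.isIso_gapMap {n : ℕ} {f : X ⟶ Y} (hf : IsHypercover n f)
    (hX : IsLieGroupoid n X) (hY : IsLieGroupoid n Y) {k : ℕ} (hk : n ≤ k) :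
    IsIso (gapMap (SSet.boundary.{u} k).ι f) := by
  induction k, hk using Nat.le_induction with
  | base => exact (isHypercover_iff.1 hf).2
  | succ k hk ih =>
    rw [isIso_gapMap_iff] at ih ⊢
    intro T b c h
    have hX' := isIso_homSpaceRestrict_iff.1 ((isLieGroupoid_iff.1 hX).2 (k + 1) 0 (by lia)) T
    have hY' := isIso_homSpaceRestrict_iff.1 ((isLieGroupoid_iff.1 hY).2 (k + 1) 0 (by lia)) T
    refine SSet.existsUnique_boundary_filler ((simplicialPointsMap f).app T) k hX'
      (fun z z' hz => (hY' _).unique hz rfl) (fun z z' hz hz' => ?_) b c h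
    exact (ih T _ _ ((Category.assoc _ _ _).trans rfl)).unique ⟨hz, hz'⟩ ⟨rfl, rfl⟩

/-- The maps of simplicial sets whose gap map against `f` is a cover. -/
def coveredBy (f : X ⟶ Y) : MorphismProperty SSet.{u} := fun _ _ i => presheafCovers (gapMap i f)

instance (f : X ⟶ Y) : (coveredBy f).IsMultiplicative where
  id_mem A := by
    have : IsIso (gapMap (𝟙 A) f) := isIso_gapMap_iff.2 fun T a c h =>
      ⟨a, ⟨Category.id_comp _, h.trans (Category.id_comp _)⟩,
        fun z hz => (Category.id_comp _).symm.trans hz.1⟩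
    exact presheafCovers_of_isIso _
  comp_mem i j hi hj := by
    change presheafCovers (gapMap (i ≫ j) f)
    rw [gapMap_comp_left]
    exact MorphismProperty.comp_mem _ _ _ hj
      (MorphismProperty.of_isPullback (isPullback_gapMap_comp_left i j f) hi)

instance (f : X ⟶ Y) : (coveredBy f).IsStableUnderCobaseChange where
  of_isPushout sq hi := MorphismProperty.of_isPullback (P := presheafCovers)
    (isPullback_gapMap_of_isPushout sq f) hi

section Covered

variable {f : X ⟶ Y} (hf : ∀ k, presheafCovers (gapMap (SSet.boundary.{u} k).ι f)) {N : ℕ}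
include hf

/-- The inclusion of `A` into a simplex is a composite of cobase changes of boundary inclusions. -/
lemma presheafCovers_gapMap_subcomplex (A : (SSet.stdSimplex.{u}.obj (.mk N)).Subcomplex) :
    presheafCovers (gapMap A.ι f) := by
  have h : coveredBy f (SSet.Subcomplex.homOfLE (le_top : A ≤ ⊤)) :=
    SSet.homOfLE_mem_of_boundary_mem (coveredBy f) hf _
  exact (coveredBy f).comp_mem _ _ h
    ((coveredBy f).of_isIso (SSet.Subcomplex.topIso (SSet.stdSimplex.obj (.mk N))).hom)

omit hf in
/-- If `A` is empty, then the target of the gap map at `A → B` is `Hom(B, Y)`. -/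
lemma presheafCovers_homSpaceMap_of_isInitial (hA : Limits.IsInitial A) (i : A ⟶ B)
    (hi : presheafCovers (gapMap i f)) : presheafCovers (homSpaceMap B f) := by
  have : IsIso (gapSnd i f) := (NatTrans.isIso_iff_isIso_app _).2 fun T =>
    (isIso_iff_bijective _).2 ⟨fun p q h => Subtype.ext (Prod.ext (hA.hom_ext _ _) h),
      fun c => ⟨⟨(hA.to _, c), hA.hom_ext _ _⟩, rfl⟩⟩
  rw [← gapMap_comp_gapSnd i f]
  exact MorphismProperty.comp_mem _ _ _ hi (presheafCovers_of_isIso (gapSnd i f))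

lemma presheafCovers_homSpaceMap_subcomplex (A : (SSet.stdSimplex.{u}.obj (.mk N)).Subcomplex) :
    presheafCovers (homSpaceMap (A : SSet.{u}) f) :=
  presheafCovers_homSpaceMap_of_isInitial SSet.Subcomplex.isInitialBot
    (SSet.Subcomplex.homOfLE (bot_le : ⊥ ≤ A))
    (SSet.homOfLE_mem_of_boundary_mem (coveredBy f) hf _)

lemma presheafCovers_homSpaceMap_stdSimplex :
    presheafCovers (homSpaceMap (SSet.stdSimplex.{u}.obj (.mk N)) f) :=
  presheafCovers_homSpaceMap_of_isInitial SSet.Subcomplex.isInitialBot _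
    (presheafCovers_gapMap_subcomplex hf ⊥)

end Covered

lemma IsHypercover.presheafCovers_gapMap {n : ℕ} {f : X ⟶ Y} (hf : IsHypercover n f)
    (hX : IsLieGroupoid n X) (hY : IsLieGroupoid n Y) (k : ℕ) :
    presheafCovers (gapMap (SSet.boundary.{u} k).ι f) := by
  rcases lt_or_ge k n with h | h
  · exact ((isHypercover_iff.1 hf).1 k h).2
  · have := hf.isIso_gapMap hX hY h
    exact presheafCovers_of_isIso _

end Hypercover

/-! ### Identity, composition and base change of hypercovers -/

section Stability

variable {X Y Z X' Y' : SimplicialManifold.{u}} {n : ℕ}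

lemma isIso_gapMap_of_isIso {A B : SSet.{u}} (i : A ⟶ B) (f : X ⟶ Y) [IsIso f] :
    IsIso (gapMap i f) := by
  refine isIso_gapMap_iff.2 fun T a c h => ?_
  have h1 : (simplicialPointsMap (inv f)).app T ≫ (simplicialPointsMap f).app T = 𝟙 _ :=
    congrArg (fun k : Y ⟶ Y => (simplicialPointsMap k).app T) (IsIso.inv_hom_id f)
  have h2 : (simplicialPointsMap f).app T ≫ (simplicialPointsMap (inv f)).app T = 𝟙 _ :=
    congrArg (fun k : X ⟶ X => (simplicialPointsMap k).app T) (IsIso.hom_inv_id f)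
  refine ⟨c ≫ (simplicialPointsMap (inv f)).app T, ⟨?_, ?_⟩, fun z hz => ?_⟩
  · rw [← Category.assoc, ← h, Category.assoc, h2, Category.comp_id]
  · rw [Category.assoc, h1, Category.comp_id]
  · rw [← hz.2, Category.assoc, h2, Category.comp_id]

/-- The relative matching spaces of a composite are manifolds because they cover those of the second
map: by `isPullback_gapSpaceMap_comp` they are base changes of `Hom(∂Δ[i], X) → Hom(∂Δ[i], Y)`. -/
lemma IsHypercover.comp {f : X ⟶ Y} {g : Y ⟶ Z} (hf : IsHypercover n f) (hg : IsHypercover n g)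
    (hX : IsLieGroupoid n X) (hY : IsLieGroupoid n Y) : IsHypercover n (f ≫ g) := by
  have hf' := hf.presheafCovers_gapMap hX hY
  rw [isHypercover_iff] at hf hg ⊢
  refine ⟨fun i hi => ⟨?_, ?_⟩, ?_⟩
  · exact isRepresentable_of_presheafCovers (MorphismProperty.of_isPullback
      (isPullback_gapSpaceMap_comp (SSet.boundary.{u} i).ι f g)
      (presheafCovers_homSpaceMap_subcomplex hf' (SSet.boundary.{u} i))) (hg.1 i hi).1
  · rw [gapMap_comp_right]
    exact MorphismProperty.comp_mem _ _ _ (hf.1 i hi).2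
      (MorphismProperty.of_isPullback (isPullback_gapMap_comp_right _ f g) (hg.1 i hi).2)
  · have := hf.2
    have := hg.2
    have := (isPullback_gapMap_comp_right (SSet.boundary.{u} n).ι f g).isIso_snd_of_isIso
    rw [gapMap_comp_right]
    infer_instance

section BaseChange

variable {f : X ⟶ Y} {f' : X' ⟶ Y'} {p : X' ⟶ X} {q : Y' ⟶ Y}
  (sq : ∀ k : ℕ, IsPullback (p.app (op (.mk k))) (f'.app (op (.mk k)))
    (f.app (op (.mk k))) (q.app (op (.mk k))))

include sq

/-- The horn projections of the base change `X'` of `X` are composites of a base change of the gap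
map of `f` at the horn and a base change of the horn projection of `Y'`. The horn spaces of `X'` are
manifolds because they cover those of `Y'`. -/
lemma IsLieGroupoid.of_isPullback (hf : IsHypercover n f) (hX : IsLieGroupoid n X)
    (hY : IsLieGroupoid n Y) (hY' : IsLieGroupoid n Y') : IsLieGroupoid n X' := by
  have hf' := hf.presheafCovers_gapMap hX hY
  rw [isLieGroupoid_iff] at hX hY hY' ⊢
  refine ⟨fun l j hl => ⟨?_, ?_⟩, fun l j hl => ?_⟩
  · exact isRepresentable_of_presheafCovers (MorphismProperty.of_isPullback
      (isPullback_homSpaceMap sq _)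
      (presheafCovers_homSpaceMap_subcomplex hf' (SSet.horn.{u} l j))) (hY'.1 l j hl).1
  · rw [← gapMap_comp_gapFst _ f']
    exact MorphismProperty.comp_mem _ _ _
      (MorphismProperty.of_isPullback (isPullback_gapMap_of_levelwise sq _)
        (presheafCovers_gapMap_subcomplex hf' _))
      (MorphismProperty.of_isPullback (isPullback_gapSpace _ f').flip (hY'.1 l j hl).2)
  · have h1 := hX.2 l j hl
    have h2 := hY.2 l j hl
    have h3 := hY'.2 l j hl
    have h4 := (isPullback_gapSpace (SSet.horn.{u} l j).ι f).isIso_fst_of_isIso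
    have h5 := (isPullback_gapSpace (SSet.horn.{u} l j).ι f').isIso_fst_of_isIso
    rw [← gapMap_comp_gapFst _ f, isIso_comp_right_iff] at h1
    have h6 := (isPullback_gapMap_of_levelwise sq (SSet.horn.{u} l j).ι).isIso_snd_of_isIso
    rw [← gapMap_comp_gapFst _ f']
    infer_instance

/-- The relative matching spaces of the base change `f'` of `f` along `q` are manifolds because they
cover those of `f`, which needs `q` to be a cover. -/
lemma IsHypercover.of_isPullback (hf : IsHypercover n f)
    (hq : ∀ k, presheafCovers (gapMap (SSet.boundary.{u} k).ι q)) : IsHypercover n f' := by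
  rw [isHypercover_iff] at hf ⊢
  refine ⟨fun i hi => ⟨?_, ?_⟩, ?_⟩
  · exact isRepresentable_of_presheafCovers (MorphismProperty.of_isPullback
      (isPullback_gapSpaceMap_of_levelwise sq _)
      (presheafCovers_homSpaceMap_stdSimplex hq)) (hf.1 i hi).1
  · exact MorphismProperty.of_isPullback (isPullback_gapMap_of_levelwise sq _) (hf.1 i hi).2
  · have := hf.2
    exact (isPullback_gapMap_of_levelwise sq (SSet.boundary.{u} n).ι).isIso_snd_of_isIso

end BaseChange

/-- The identity is a hypercover: its relative matching spaces are the manifolds `X_i`. -/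
lemma IsHypercover.id (X : SimplicialManifold.{u}) (n : ℕ) : IsHypercover n (𝟙 X) := by
  refine isHypercover_iff.2 ⟨fun i _ => ?_, isIso_gapMap_of_isIso _ _⟩
  have := isIso_gapMap_of_isIso (SSet.boundary.{u} i).ι (𝟙 X)
  exact ⟨.mk' (asIso (simplexSpaceMap X i ≫ gapMap (SSet.boundary.{u} i).ι (𝟙 X))),
    presheafCovers_of_isIso _⟩

/-- Levelwise surjective submersions of simplicial manifolds can be pulled back levelwise. -/
lemma exists_levelwise_isPullback (f : X ⟶ Y) (q : Y' ⟶ Y)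
    (hf : ∀ k, surjectiveSubmersions (f.app (op (.mk k)))) :
    ∃ (W : SimplicialManifold.{u}) (p : W ⟶ X) (f' : W ⟶ Y'), ∀ k : ℕ,
      IsPullback (p.app (op (.mk k))) (f'.app (op (.mk k)))
        (f.app (op (.mk k))) (q.app (op (.mk k))) := by
  have h (c : SimplexCategoryᵒᵖ) : Limits.HasLimit ((Limits.cospan f q).flip.obj c) := by
    obtain ⟨⟨k⟩⟩ := c
    have : Limits.HasPullback (f.app (op (.mk k))) (q.app (op (.mk k))) :=
      (isPullback_fibreProduct (p := f.app (op (.mk k))) (q.app (op (.mk k))) (hf k)).hasPullback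
    exact Limits.hasLimit_of_iso (F := Limits.cospan (f.app (op (.mk k))) (q.app (op (.mk k))))
      (Limits.diagramIsoCospan ((Limits.cospan f q).flip.obj (op (.mk k)))).symm
  exact ⟨Limits.pullback f q, Limits.pullback.fst f q, Limits.pullback.snd f q, fun k =>
    (IsPullback.of_hasPullback f q).map
      ((evaluation SimplexCategoryᵒᵖ BanachManifold.{u}).obj (op (SimplexCategory.mk k)))⟩

end Stability

/-! ### Symplectic Morita equivalence -/

theorem mainTheorem8 (m n : ℕ) :
    _root_.Equivalence
      (SymplecticMoritaEquivalent : ShiftedSymplecticLieGroupoid.{u} m n →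
        ShiftedSymplecticLieGroupoid.{u} m n → Prop) := by
  refine ⟨fun K => ?_, ?_, ?_⟩
  · refine ⟨K.space, 𝟙 _, 𝟙 _, 0, K.isLieGroupoid, .id _ _, .id _ _, .zero, ?_⟩
    rw [sub_self, DoubleForm.D_zero]
  · rintro K J ⟨Z, f, g, φ, hZ, hf, hg, hφ, h⟩
    refine ⟨Z, g, f, (-1 : ℝ) • φ, hZ, hg, hf, hφ.smul _, ?_⟩
    rw [DoubleForm.D_smul, ← h]
    exact (neg_sub _ _).symm.trans (neg_one_smul ℝ _).symm
  · rintro K J L ⟨Z, f, g, φ, hZ, hf, hg, hφ, h⟩ ⟨Z', f', g', φ', hZ', hf', hg', hφ', h'⟩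
    have cg := hg.presheafCovers_gapMap hZ J.isLieGroupoid
    have cf' := hf'.presheafCovers_gapMap hZ' J.isLieGroupoid
    obtain ⟨W, p, p', sq⟩ := exists_levelwise_isPullback g f' fun k =>
      surjectiveSubmersions_app_of_homSpaceMap (presheafCovers_homSpaceMap_stdSimplex cg)
    have hW : IsLieGroupoid n W := .of_isPullback sq hg hZ J.isLieGroupoid hZ'
    have hp : IsHypercover n p := .of_isPullback (fun k => (sq k).flip) hf' cg
    have hp' : IsHypercover n p' := .of_isPullback sq hg cf'
    refine ⟨W, p ≫ f, p' ≫ g', DoubleForm.pullback p φ + DoubleForm.pullback p' φ', hW,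
      hp.comp hf hW hZ, hp'.comp hg' hW hZ', (hφ.pullback p).add (hφ'.pullback p'), ?_⟩
    -- The two pullbacks of the form on `J` to `W` agree, so they cancel.
    rw [DoubleForm.D_add (hφ.pullback p).smooth (hφ'.pullback p').smooth,
      DoubleForm.D_pullback _ hφ.smooth, DoubleForm.D_pullback _ hφ'.smooth, ← h, ← h',
      DoubleForm.pullback_sub, DoubleForm.pullback_sub, ← DoubleForm.pullback_comp,
      ← DoubleForm.pullback_comp, ← DoubleForm.pullback_comp, ← DoubleForm.pullback_comp,
      comp_eq_of_levelwise sq, sub_add_sub_cancel]
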